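/- **Theorem.** In the $\mathsf{LOCAL}$ model the network is a simple undirected graph $G=(V,E)$ with $n$ nodes, not necessarily connected. The nodes have distinct identifiers that are non-negative integers at most $n^{c}$ for a constant $c$ (so $O(\log n)$ bits), and each node numbers its incident edges arbitrarily by ports. Initially a node knows $n$, its identifier and its degree. In each synchronous round every node sends a message of arbitrary size to each of its neighbors and performs arbitrary local computation. At the end every node outputs a label for each of its incident edges, and the two endpoints of an edge must give it consistent labels. The running time is the number of rounds. For every $c\in\mathbb{N}$ there is a constant $C>0$, depending only on $c$, such that for every real $\varepsilon>0$ there are deterministic $\mathsf{LOCAL}$ algorithms for (a) and (b) below which run, on every $n$-node graph, in at most $$C\cdot a\cdot\log a\cdot(\log\log a)^{1.71}\cdot\log n,\qquad a=\max\{\varepsilon^{-1},4\},$$ rounds; that is, in $O\big(\varepsilon^{-1}\cdot\log\varepsilon^{-1}\cdot(\log\log\varepsilon^{-1})^{1.71}\cdot\log n\big)$ rounds for $\varepsilon\le 1/4$, and in $O(\log n)$ rounds for $\varepsilon>1/4$. Here $\log$ is the natural logarithm, with the convention that the bound is $0$ if $n=0$. Write $d(v)$ for the degree of $v$. (a) Directed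 degree splitting: the algorithm orients every edge of $G$ such that at each node $v$ the absolute difference between the numbers of outgoing and incoming edges is at most $\varepsilon\, d(v)+1$ if $d(v)$ is odd, and at most $\varepsilon\, d(v)+2$ if $d(v)$ is even. (b) Undirected degree splitting: the algorithm colors every edge of $G$ red or blue such that at each node $v$ the absolute difference between the numbers of red and blue edges at $v$ is at most $\varepsilon\, d(v)+4$. -/

import Mathlib

universe u

/-- A deterministic algorithm in the `LOCAL` model whose nodes write one label of type `Out` on each
of their incident edges. A node initially knows the number `n` of nodes, its own identifier and its
degree `d`; its incident edges are told apart by the port numbers in `Fin d`. Messages, memory and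
local computation are unrestricted; the only cost is the number of communication rounds. -/
structure LocalAlgorithm (Out : Type) where
  /-- The possible local states of a node. -/
  State : Type
  /-- The possible messages. -/
  Msg : Type
  /-- `init n ident d` is the initial state. -/
  init : (n ident d : ℕ) → State
  /-- The message sent through each port in a round. -/
  send : (d : ℕ) → State → Fin d → Msg
  /-- The new state, computed from the old one and from the messages received at the ports. -/
  step : (d : ℕ) → State → (Fin d → Msg) → State
  /-- `rounds n` is the number of communication rounds executed on `n`-node graphs. -/
  rounds : (n : ℕ) → ℕ
  /-- The labels written on the incident edges at the end. -/
  output : (d : ℕ) → State → Fin d → Out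

/-- Turns the graph `G` into a network: the nodes get distinct identifiers, and every node numbers
its incident edges by ports. Both are arbitrary. -/
structure Network {V : Type*} [Fintype V] (G : SimpleGraph V) [DecidableRel G.Adj] where
  /-- The identifier of a node. -/
  ident : V → ℕ
  ident_injective : Function.Injective ident
  /-- The neighbor behind each port of a node. -/
  port : (v : V) → Fin (G.degree v) ≃ G.neighborSet v

namespace Network

variable {V : Type*} [Fintype V] {G : SimpleGraph V} [DecidableRel G.Adj]

/-- The port of `v` that leads to its neighbor `w`. -/
def portTo (N : Network G) {v w : V} (h : G.Adj v w) : Fin (G.degree v) :=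
  (N.port v).symm ⟨w, h⟩

end Network

namespace LocalAlgorithm

variable {Out : Type} {V : Type*} [Fintype V] {G : SimpleGraph V} [DecidableRel G.Adj]

/-- The state of each node after `t` synchronous rounds. In every round each node sends a message
through each of its ports, and the message received at port `i` of `v` is the one that the
neighbor behind port `i` sent through its port towards `v`. -/
def stateAfter (A : LocalAlgorithm Out) (N : Network G) : ℕ → V → A.State
  | 0, v => A.init (Fintype.card V) (N.ident v) (G.degree v)
  | t + 1, v =>
      A.step (G.degree v) (A.stateAfter N t v) fun i =>
        A.send (G.degree (N.port v i : V)) (A.stateAfter N t (N.port v i))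
          (N.portTo (SimpleGraph.Adj.symm (N.port v i).2))

/-- The label that node `v` writes on its edge to `w`. -/
def label (A : LocalAlgorithm Out) (N : Network G) {v w : V} (h : G.Adj v w) : Out :=
  A.output (G.degree v) (A.stateAfter N (A.rounds (Fintype.card V)) v) (N.portTo h)

end LocalAlgorithm

/-- `D` is an orientation of `G`: it contains exactly one of `(u, v)`, `(v, u)` for every edge
`{u, v}` of `G`, and nothing else. -/
def IsOrientation {V : Type*} (G : SimpleGraph V) (D : Digraph V) : Prop :=
  (∀ u v, D.Adj u v → G.Adj u v) ∧ ∀ u v, G.Adj u v → Xor (D.Adj u v) (D.Adj v u)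

/-- The difference between the numbers of outgoing and incoming edges of `v`. -/
noncomputable def directedDiscrepancy {V : Type*} (D : Digraph V) (v : V) : ℝ :=
  |({w | D.Adj v w}.ncard : ℝ) - ({w | D.Adj w v}.ncard : ℝ)|

/-- The difference between the numbers of edges at `v` colored `1` (red) and `-1` (blue). -/
noncomputable def undirectedDiscrepancy {V : Type*} [Fintype V] [DecidableEq V]
    (G : SimpleGraph V) [DecidableRel G.Adj] (q : Sym2 V → ℤˣ) (v : V) : ℝ :=
  |∑ e ∈ G.incidenceFinset v, ((q e : ℤ) : ℝ)|

/-- The two labels an endpoint can give to an edge in an orientation. -/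
inductive EdgeDirection : Type
  | outgoing
  | incoming

/-- The labels of all the nodes together describe the orientation `D`: `v` calls its edge to `w`
outgoing if `D` directs it from `v` to `w`, and incoming if `D` directs it from `w` to `v`. -/
def LocalAlgorithm.ComputesOrientation {V : Type*} [Fintype V] {G : SimpleGraph V}
    [DecidableRel G.Adj] (A : LocalAlgorithm EdgeDirection) (N : Network G) (D : Digraph V) :
    Prop :=
  ∀ (v w : V) (h : G.Adj v w),
    (A.label N h = EdgeDirection.outgoing ↔ D.Adj v w) ∧
    (A.label N h = EdgeDirection.incoming ↔ D.Adj w v)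

/-- Both endpoints of every edge `e` label it with its color `q e`. -/
def LocalAlgorithm.ComputesColoring {V : Type*} [Fintype V] {G : SimpleGraph V}
    [DecidableRel G.Adj] (A : LocalAlgorithm ℤˣ) (N : Network G) (q : Sym2 V → ℤˣ) : Prop :=
  ∀ (v w : V) (h : G.Adj v w), A.label N h = q s(v, w)

/-- `A` computes, on every graph whose identifiers are bounded by `n ^ c` (so have `O(log n)` bits),
an orientation with discrepancy at most `ε d(v) + 1` at nodes of odd degree and at most
`ε d(v) + 2` at nodes of even degree. -/
def LocalAlgorithm.SolvesDirectedSplitting (A : LocalAlgorithm EdgeDirection) (c : ℕ) (ε : ℝ) :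
    Prop :=
  ∀ (V : Type u) [Fintype V] (G : SimpleGraph V) [DecidableRel G.Adj] (N : Network G),
    (∀ v, N.ident v ≤ Fintype.card V ^ c) →
    ∃ D : Digraph V, IsOrientation G D ∧ A.ComputesOrientation N D ∧
      ∀ v : V,
        (Odd (G.degree v) → directedDiscrepancy D v ≤ ε * G.degree v + 1) ∧
        (Even (G.degree v) → directedDiscrepancy D v ≤ ε * G.degree v + 2)

/-- `A` computes, on every graph whose identifiers are bounded by `n ^ c` (so have `O(log n)` bits),
a red/blue coloring of the edges with discrepancy at most `ε d(v) + 4` at every node. -/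
def LocalAlgorithm.SolvesUndirectedSplitting (A : LocalAlgorithm ℤˣ) (c : ℕ) (ε : ℝ) : Prop :=
  ∀ (V : Type u) [Fintype V] [DecidableEq V] (G : SimpleGraph V) [DecidableRel G.Adj]
    (N : Network G),
    (∀ v, N.ident v ≤ Fintype.card V ^ c) →
    ∃ q : Sym2 V → ℤˣ, A.ComputesColoring N q ∧
      ∀ v : V, undirectedDiscrepancy G q v ≤ ε * G.degree v + 4

/-- The bound `a * log a * (log log a) ^ 1.71 * log n` with `a = ε⁻¹`; for `ε > 1 / 4`, where the
iterated logarithm may be negative or undefined, `a = 4` is used instead. -/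
noncomputable def splittingTime (ε : ℝ) (n : ℕ) : ℝ :=
  max ε⁻¹ 4 * Real.log (max ε⁻¹ 4) * Real.log (Real.log (max ε⁻¹ 4)) ^ (1.71 : ℝ) * Real.log n

/-! Let k = ⌈1/ε⌉. Every node is split into groups of 2k incident half-edges and one smaller group;
for the coloring, the edges towards larger and towards smaller identifiers are first separated into
two sides. It suffices to orient the edges so that each group has discrepancy at most 2, and at most
1 if its size is odd (`splitting_spec`): the ⌊d/(2k)⌋ full groups cost at most ε d together, and the
last group has the parity of d (`abs_sum_groups_le`). For the coloring, an edge is red iff it points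
to the larger identifier, and each of the two sides adds at most 2.

Take the groups as nodes, of degree at most 2k. Pairing the half-edges at every node decomposes the
edges into trails. Orienting whole trails would be balanced but is not local, so trails are cut, at
no more than one half-edge per node. A ruling set marks windows of 4k half-edges on the trails. The
windows are disjoint, so any set of windows passes through at least twice as many nodes. By Hall's
theorem and a doubling argument, every window lies in a family of windows of logarithmic radius that
can be cut at distinct nodes through which no other window passes (`exists_closed_matching`).

At a node of even degree the two halves of a cut pair become ends of trails; at a node of odd degree
they are joined with the left-over half-edge to a branching of degree 3. If every joined class of at
least two half-edges has both an outgoing and an incoming one, then pairs cancel, a triple has sum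
±1 and two ends have sum at most 2 in absolute value (`abs_sum_le`). Within O(k) steps a trail now
ends, branches or runs around a cycle. Trails that only ever branch would form a binary tree with
more leaves than there are half-edges after O(log n) branchings, so an end or a cycle is within
distance O(k log n) (`exists_anchor_or_tree`), and the edges leading there can be oriented as
required (`exists_orientation`).

Such local solutions are merged by a canonical choice: each object follows the solution of least
code among all locally valid ones that touch it (`leastCode_eq_of_subset`). The result at a
half-edge depends only on a ball of radius O(k log n), which is collected by flooding. This takes
O(a log n) rounds; the remaining factors of the claimed bound are bounded from below because a ≥ 4.
-/

namespace DegreeSplitting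

/-- The half of the edge between the nodes with identifiers `h.1` and `h.2` that lies at `h.1`. -/
abbrev HalfEdge := ℕ × ℕ

/-- The relation of two half-edges to be incident to the same node. -/
abbrev Incidence := HalfEdge → HalfEdge → Prop

/-- `g` is reached from `h` by at most `r` steps, each of which moves to the other half of the
current edge or to another half-edge at the current node. -/
def Near (E : Incidence) : ℕ → HalfEdge → HalfEdge → Prop
  | 0, h, g => g = h
  | r + 1, h, g => ∃ f, Near E r h f ∧ (g = f ∨ g = f.swap ∨ E f g)

theorem Near.refl (E : Incidence) (h : HalfEdge) : Near E 0 h h := rfl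

theorem Near.succ {E : Incidence} {r : ℕ} {h g : HalfEdge} (H : Near E r h g) :
    Near E (r + 1) h g := ⟨g, H, Or.inl rfl⟩

theorem Near.swap {E : Incidence} {r : ℕ} {h g : HalfEdge} (H : Near E r h g) :
    Near E (r + 1) h g.swap := ⟨g, H, Or.inr (Or.inl rfl)⟩

theorem Near.rel {E : Incidence} {r : ℕ} {h g f : HalfEdge} (H : Near E r h g) (hf : E g f) :
    Near E (r + 1) h f := ⟨g, H, Or.inr (Or.inr hf)⟩

theorem Near.mono {E : Incidence} {r s : ℕ} {h g : HalfEdge} (H : Near E r h g) (hs : r ≤ s) :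
    Near E s h g := by
  induction hs with
  | refl => exact H
  | step _ ih => exact ih.succ

theorem Near.trans {E : Incidence} {r s : ℕ} {h f g : HalfEdge} (H : Near E r h f)
    (H' : Near E s f g) : Near E (r + s) h g := by
  induction s generalizing g with
  | zero => cases H'; exact H
  | succ s ih =>
    obtain ⟨f', h1, h2⟩ := H'
    exact ⟨f', ih h1, h2⟩

/-- `E` and `E'` agree on the ball of radius `r` around `h`. -/
def Agree (E E' : Incidence) (r : ℕ) (h : HalfEdge) : Prop :=
  ∀ g, Near E r h g → ∀ f, E g f ↔ E' g f

theorem Agree.rel {E E' : Incidence} {r : ℕ} {h : HalfEdge} (A : Agree E E' r h) (f : HalfEdge) :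
    E h f ↔ E' h f :=
  A h ((Near.refl E h).mono (Nat.zero_le r)) f

theorem Agree.at {E E' : Incidence} {r s t : ℕ} {h g : HalfEdge} (A : Agree E E' r h)
    (hg : Near E s h g) (hs : s + t ≤ r) : Agree E E' t g :=
  fun f hf => A f ((hg.trans hf).mono hs)

theorem Agree.mono {E E' : Incidence} {r s : ℕ} {h : HalfEdge} (A : Agree E E' r h)
    (hs : s ≤ r) : Agree E E' s h :=
  A.at (Near.refl E h) (by omega)

/-- Reaching the sphere of radius r only uses the relation on smaller balls. In all locality
statements only `E` has to be a true incidence; `E'` stands for what a node has learned, which may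
be cut off arbitrarily outside the ball. -/
theorem Agree.near_iff {E E' : Incidence} {r : ℕ} {h : HalfEdge} (A : Agree E E' r h)
    (g : HalfEdge) : Near E r h g ↔ Near E' r h g := by
  induction r generalizing g with
  | zero => exact Iff.rfl
  | succ r ih =>
    have A' : Agree E E' r h := A.mono (Nat.le_succ r)
    constructor
    · rintro ⟨f, hf, H⟩
      exact ⟨f, (ih A' f).1 hf, by rwa [← A f hf.succ]⟩
    · rintro ⟨f, hf, H⟩
      have hf' := (ih A' f).2 hf
      exact ⟨f, hf', by rwa [A f hf'.succ]⟩

/-- `E` describes the half-edges of a graph with nodes of finite degree, a half-edge `h` being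
present if `E h h`. -/
structure IsIncidence (E : Incidence) : Prop where
  symm : ∀ {h g}, E h g → E g h
  trans : ∀ {h g f}, E h g → E g f → E h f
  swap : ∀ {h}, E h h → E h.swap h.swap
  swap_ne : ∀ {h}, E h h → h.swap ≠ h
  finite : ∀ h, {g | E h g}.Finite

namespace IsIncidence

variable {E : Incidence}

theorem left (hE : IsIncidence E) {h g : HalfEdge} (H : E h g) : E h h := hE.trans H (hE.symm H)

theorem right (hE : IsIncidence E) {h g : HalfEdge} (H : E h g) : E g g := hE.left (hE.symm H)

theorem near_symm (hE : IsIncidence E) {r : ℕ} {h g : HalfEdge} (H : Near E r h g) :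
    Near E r g h := by
  have main : ∀ {r : ℕ} {h f g : HalfEdge}, (f = g ∨ f = g.swap ∨ E g f) → Near E r f h →
      Near E (r + 1) g h := by
    intro r h f g h1 h2
    have : Near E 1 g f := ⟨g, rfl, h1⟩
    rw [Nat.add_comm]
    exact this.trans h2
  induction r generalizing g with
  | zero => exact Eq.symm H
  | succ r ih =>
    obtain ⟨f, hf, H⟩ := H
    refine main ?_ (ih hf)
    rcases H with H | H | H
    · exact Or.inl H.symm
    · exact Or.inr (Or.inl (by rw [H, Prod.swap_swap]))
    · exact Or.inr (Or.inr (hE.symm H))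

theorem near_valid (hE : IsIncidence E) {r : ℕ} {h g : HalfEdge} (hv : E h h)
    (H : Near E r h g) : E g g := by
  induction r generalizing g with
  | zero => cases H; exact hv
  | succ r ih =>
    obtain ⟨f, hf, rfl | rfl | H⟩ := H
    · exact ih hf
    · exact hE.swap (ih hf)
    · exact hE.right H

theorem class_eq (hE : IsIncidence E) {h g : HalfEdge} (H : E h g) :
    {f | E g f} = {f | E h f} :=
  Set.ext fun _ => ⟨fun h' => hE.trans H h', fun h' => hE.trans (hE.symm H) h'⟩

end IsIncidence

/-! ### Pairings at the nodes and the trails they form -/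

/-- Swap two elements and recurse on the rest; one element is left over exactly if the cardinality
is odd. -/
theorem exists_involution {α : Type*} (C : Set α) (hC : C.Finite) :
    ∃ f : α → α, (∀ x ∈ C, f x ∈ C) ∧ (∀ x ∈ C, f (f x) = x) ∧
      ∀ x ∈ C, ∀ y ∈ C, f x = x → f y = y → x = y := by
  classical
  obtain ⟨s, rfl⟩ := hC.exists_finset_coe
  clear hC
  induction s using Finset.strongInduction with
  | H s ih =>
    by_cases hs : ∃ a ∈ s, ∃ b ∈ s, a ≠ b
    · obtain ⟨a, ha, b, hb, hab⟩ := hs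
      obtain ⟨f, h1, h2, h3⟩ := ih ((s.erase a).erase b)
        ((Finset.erase_subset _ _).trans_ssubset (Finset.erase_ssubset ha))
      simp only [Finset.mem_coe, Finset.mem_erase] at h1 h2 h3 ⊢
      refine ⟨fun x => if x = a then b else if x = b then a else f x, ?_, ?_, ?_⟩
      · intro x hx
        by_cases hxa : x = a
        · simp [hxa, hb]
        by_cases hxb : x = b
        · simp [hxb, hab.symm, ha]
        simp [hxa, hxb, (h1 x ⟨hxb, hxa, hx⟩).2.2]
      · intro x hx
        by_cases hxa : x = a
        · simp [hxa, hab.symm]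
        by_cases hxb : x = b
        · simp [hxb, hab.symm]
        have := h1 x ⟨hxb, hxa, hx⟩
        simp [hxa, hxb, this.1, this.2.1, h2 x ⟨hxb, hxa, hx⟩]
      · intro x hx y hy
        have aux : ∀ z, (if z = a then b else if z = b then a else f z) = z →
            z ≠ a ∧ z ≠ b ∧ f z = z := by
          intro z hz
          by_cases hza : z = a
          · subst hza; simp at hz; exact absurd hz.symm hab
          by_cases hzb : z = b
          · subst hzb; simp [hza] at hz; exact absurd hz hab
          simpa [hza, hzb] using hz
        intro hfx hfy
        obtain ⟨hxa, hxb, hx'⟩ := aux x hfx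
        obtain ⟨hya, hyb, hy'⟩ := aux y hfy
        exact h3 x ⟨hxb, hxa, hx⟩ y ⟨hyb, hya, hy⟩ hx' hy'
    · push Not at hs
      exact ⟨id, fun x hx => hx, fun x _ => rfl, fun x hx y hy _ _ => hs x hx y hy⟩

open Classical in
/-- An involution of the finite set `C` with at most one fixed point. -/
noncomputable def pairing (C : Set HalfEdge) : HalfEdge → HalfEdge :=
  if hC : C.Finite then (exists_involution C hC).choose else id

theorem pairing_spec {C : Set HalfEdge} (hC : C.Finite) :
    (∀ x ∈ C, pairing C x ∈ C) ∧ (∀ x ∈ C, pairing C (pairing C x) = x) ∧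
      ∀ x ∈ C, ∀ y ∈ C, pairing C x = x → pairing C y = y → x = y := by
  simp only [pairing, dif_pos hC]
  exact (exists_involution C hC).choose_spec

/-- The half-edge paired with `h` at its node; `h` itself if it is the one that is left over. -/
noncomputable def mate (E : Incidence) (h : HalfEdge) : HalfEdge := pairing {g | E h g} h

/-- The half-edge on which a trail that leaves through `h` goes on. -/
noncomputable def fwd (E : Incidence) (h : HalfEdge) : HalfEdge := mate E h.swap

/-- The half-edge from which a trail arrives that goes on with `h`. -/
noncomputable def bwd (E : Incidence) (h : HalfEdge) : HalfEdge := (mate E h).swap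

theorem Agree.mate_eq {E E' : Incidence} {r : ℕ} {h : HalfEdge} (A : Agree E E' r h) :
    mate E h = mate E' h := by
  have : {g | E h g} = {g | E' h g} := Set.ext fun g => A.rel g
  rw [mate, this, mate]

theorem Agree.fwd_eq {E E' : Incidence} {r : ℕ} {h : HalfEdge} (A : Agree E E' (r + 1) h) :
    fwd E h = fwd E' h :=
  Agree.mate_eq (A.at (Near.refl E h).swap (t := r) (by omega))

theorem Agree.bwd_eq {E E' : Incidence} {r : ℕ} {h : HalfEdge} (A : Agree E E' r h) :
    bwd E h = bwd E' h := by
  rw [bwd, A.mate_eq, bwd]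

namespace IsIncidence

variable {E : Incidence}

theorem rel_mate (hE : IsIncidence E) {h : HalfEdge} (hv : E h h) : E h (mate E h) :=
  (pairing_spec (hE.finite h)).1 h hv

theorem mate_mate (hE : IsIncidence E) {h : HalfEdge} (hv : E h h) : mate E (mate E h) = h := by
  have h1 := hE.class_eq (hE.rel_mate hv)
  rw [mate, h1]
  exact (pairing_spec (hE.finite h)).2.1 h hv

theorem mate_fixed_unique (hE : IsIncidence E) {h g : HalfEdge} (H : E h g)
    (hh : mate E h = h) (hg : mate E g = g) : h = g := by
  have h1 := hE.class_eq H
  rw [mate, h1] at hg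
  exact (pairing_spec (hE.finite h)).2.2 h (hE.left H) g H hh hg

theorem mate_valid (hE : IsIncidence E) {h : HalfEdge} (hv : E h h) :
    E (mate E h) (mate E h) := hE.right (hE.rel_mate hv)

theorem fwd_valid (hE : IsIncidence E) {h : HalfEdge} (hv : E h h) :
    E (fwd E h) (fwd E h) := hE.mate_valid (hE.swap hv)

theorem bwd_valid (hE : IsIncidence E) {h : HalfEdge} (hv : E h h) :
    E (bwd E h) (bwd E h) := hE.swap (hE.mate_valid hv)

/-- A left-over half-edge is its own mate, so a trail turns around at its end. Hence `fwd` is a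
bijection of the present half-edges with inverse `bwd`, and trails can be followed indefinitely. -/
theorem bwd_fwd (hE : IsIncidence E) {h : HalfEdge} (hv : E h h) : bwd E (fwd E h) = h := by
  rw [bwd, fwd, hE.mate_mate (hE.swap hv), Prod.swap_swap]

theorem fwd_bwd (hE : IsIncidence E) {h : HalfEdge} (hv : E h h) : fwd E (bwd E h) = h := by
  rw [bwd, fwd, Prod.swap_swap, hE.mate_mate hv]

theorem iterate_fwd_valid (hE : IsIncidence E) {h : HalfEdge} (hv : E h h) (j : ℕ) :
    E ((fwd E)^[j] h) ((fwd E)^[j] h) := by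
  induction j with
  | zero => exact hv
  | succ j ih => rw [Function.iterate_succ_apply']; exact hE.fwd_valid ih

theorem iterate_bwd_valid (hE : IsIncidence E) {h : HalfEdge} (hv : E h h) (j : ℕ) :
    E ((bwd E)^[j] h) ((bwd E)^[j] h) := by
  induction j with
  | zero => exact hv
  | succ j ih => rw [Function.iterate_succ_apply']; exact hE.bwd_valid ih

theorem iterate_bwd_fwd (hE : IsIncidence E) {h : HalfEdge} (hv : E h h) (i j : ℕ) :
    (bwd E)^[j] ((fwd E)^[i + j] h) = (fwd E)^[i] h := by
  induction j with
  | zero => rfl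
  | succ j ih =>
    rw [Function.iterate_succ_apply, ← Nat.add_assoc, Function.iterate_succ_apply',
      hE.bwd_fwd (hE.iterate_fwd_valid hv _), ih]

theorem iterate_fwd_bwd (hE : IsIncidence E) {h : HalfEdge} (hv : E h h) (i j : ℕ) :
    (fwd E)^[j] ((bwd E)^[i + j] h) = (bwd E)^[i] h := by
  induction j with
  | zero => rfl
  | succ j ih =>
    rw [Function.iterate_succ_apply, ← Nat.add_assoc, Function.iterate_succ_apply',
      hE.fwd_bwd (hE.iterate_bwd_valid hv _), ih]

theorem near_fwd (hE : IsIncidence E) {h : HalfEdge} (hv : E h h) : Near E 2 h (fwd E h) :=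
  (Near.refl E h).swap.rel (hE.rel_mate (hE.swap hv))

theorem near_bwd (hE : IsIncidence E) {h : HalfEdge} (hv : E h h) : Near E 2 h (bwd E h) :=
  ((Near.refl E h).rel (hE.rel_mate hv)).swap

theorem near_iterate_fwd (hE : IsIncidence E) {h : HalfEdge} (hv : E h h) (j : ℕ) :
    Near E (2 * j) h ((fwd E)^[j] h) := by
  induction j with
  | zero => rfl
  | succ j ih =>
    rw [Function.iterate_succ_apply']
    exact ih.trans (hE.near_fwd (hE.iterate_fwd_valid hv j))

theorem near_iterate_bwd (hE : IsIncidence E) {h : HalfEdge} (hv : E h h) (j : ℕ) :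
    Near E (2 * j) h ((bwd E)^[j] h) := by
  induction j with
  | zero => rfl
  | succ j ih =>
    rw [Function.iterate_succ_apply']
    exact ih.trans (hE.near_bwd (hE.iterate_bwd_valid hv j))

end IsIncidence

/-! ### Closed matchings of logarithmic radius -/

section Closed

variable {X Y : Type*}

/-- A set of elements of `X` that can be matched within the elements offered only to the set. -/
def IsClosedMatching (N : X → Finset Y) (T : Finset X) (f : X → Y) : Prop :=
  Set.InjOn f T ∧ ∀ x ∈ T, f x ∈ N x ∧ ∀ x', f x ∈ N x' → x' ∈ T

open Classical in
/-- If `M` is a maximal closed set in `B`, then fewer than `T.card` further elements of `Y` are offered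
to a set `T` disjoint from `M`, and outside of `T` to `M` only: a minimal counterexample could be
added to `M`, by Hall's theorem. -/
theorem card_exclusive_lt {N : X → Finset Y} {M B : Finset X} {f : X → Y}
    (hM : IsClosedMatching N M f)
    (hmax : ∀ M' g, M ⊆ M' → M' ⊆ B → IsClosedMatching N M' g → M' = M)
    (hMB : M ⊆ B) (T : Finset X) (hT : T.Nonempty) (hTB : T ⊆ B) (hTM : Disjoint T M) :
    ((T.biUnion N).filter fun y => (∀ x, y ∈ N x → x ∈ M ∪ T)).card < T.card := by
  induction T using Finset.strongInduction with
  | H T ih =>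
    by_contra hcon
    push Not at hcon
    set S : Finset Y := (T.biUnion N).filter fun y => (∀ x, y ∈ N x → x ∈ M ∪ T) with hS
    let t : T → Finset Y := fun x => N x ∩ S
    have hall : ∀ s : Finset T, s.card ≤ (s.biUnion t).card := by
      intro s
      set s' : Finset X := s.map (Function.Embedding.subtype _) with hs'
      have hs'T : s' ⊆ T := by
        intro x hx
        rw [hs', Finset.mem_map] at hx
        obtain ⟨a, _, rfl⟩ := hx
        exact a.2
      have hcard : s.card = s'.card := by simp [hs']
      rw [hcard]
      by_cases hne : s'.Nonempty
      swap
      · rw [Finset.not_nonempty_iff_eq_empty.1 hne]; simp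
      -- An element of `S` offered to nobody in `s'` is exclusive to `T \ s'`, and by induction
      -- there are at most `(T \ s').card` of these. The remaining ones, at least `s'.card` many,
      -- verify Hall's condition for `s'`.
      have hsplit : S ⊆ (s.biUnion t) ∪
          (((T \ s').biUnion N).filter fun y => (∀ x, y ∈ N x → x ∈ M ∪ (T \ s'))) := by
        intro y hy
        have hy' := hy
        rw [hS, Finset.mem_filter, Finset.mem_biUnion] at hy'
        obtain ⟨⟨x, hx, hxy⟩, hyall⟩ := hy'
        by_cases hys : ∃ a : T, a ∈ s ∧ y ∈ N a
        · obtain ⟨a, ha, hay⟩ := hys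
          exact Finset.mem_union_left _ (Finset.mem_biUnion.2 ⟨a, ha, Finset.mem_inter.2 ⟨hay, hy⟩⟩)
        · have hnot : ∀ z, y ∈ N z → z ∉ s' := by
            intro z hz hzs
            rw [hs', Finset.mem_map] at hzs
            obtain ⟨a, ha, rfl⟩ := hzs
            exact hys ⟨a, ha, hz⟩
          refine Finset.mem_union_right _ (Finset.mem_filter.2 ⟨Finset.mem_biUnion.2
            ⟨x, Finset.mem_sdiff.2 ⟨hx, hnot x hxy⟩, hxy⟩, fun z hz => ?_⟩)
          rcases Finset.mem_union.1 (hyall z hz) with h | h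
          · exact Finset.mem_union_left _ h
          · exact Finset.mem_union_right _ (Finset.mem_sdiff.2 ⟨h, hnot z hz⟩)
      have h1 := (Finset.card_le_card hsplit).trans (Finset.card_union_le _ _)
      have h2 : (((T \ s').biUnion N).filter
          fun y => (∀ x, y ∈ N x → x ∈ M ∪ (T \ s'))).card ≤ (T \ s').card := by
        by_cases hd : (T \ s').Nonempty
        · exact (ih (T \ s') (Finset.sdiff_ssubset hs'T hne) hd
            (Finset.sdiff_subset.trans hTB)
            (Finset.disjoint_of_subset_left Finset.sdiff_subset hTM)).le
        · rw [Finset.not_nonempty_iff_eq_empty.1 hd]; simp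
      have h3 : (T \ s').card + s'.card = T.card := Finset.card_sdiff_add_card_eq_card hs'T
      omega
    obtain ⟨g, hginj, hg⟩ := (Finset.all_card_le_biUnion_card_iff_exists_injective t).1 hall
    let F : X → Y := fun x => if hx : x ∈ T then g ⟨x, hx⟩ else f x
    have hF : IsClosedMatching N (M ∪ T) F := by
      have hFT : ∀ x (hx : x ∈ T), F x = g ⟨x, hx⟩ := fun x hx => dif_pos hx
      have hFM : ∀ x ∈ M, F x = f x := fun x hx =>
        dif_neg fun hx' => (Finset.disjoint_left.1 hTM hx') hx
      -- The two matchings cannot collide: what `f` uses is offered only within `M`, since `M` is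
      -- closed.
      have cross : ∀ x ∈ M, ∀ z ∈ T, F x ≠ F z := by
        intro x hx z hz hxz
        rw [hFM x hx, hFT z hz] at hxz
        have := (hM.2 x hx).2 z (by rw [hxz]; exact (Finset.mem_inter.1 (hg ⟨z, hz⟩)).1)
        exact Finset.disjoint_left.1 hTM hz this
      refine ⟨?_, ?_⟩
      · intro x hx z hz hxz
        rw [Finset.mem_coe, Finset.mem_union] at hx hz
        rcases hx with hx | hx <;> rcases hz with hz | hz
        · rw [hFM x hx, hFM z hz] at hxz; exact hM.1 hx hz hxz
        · exact absurd hxz (cross x hx z hz)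
        · exact absurd hxz.symm (cross z hz x hx)
        · rw [hFT x hx, hFT z hz] at hxz
          exact congrArg Subtype.val (hginj hxz)
      · intro x hx
        rcases Finset.mem_union.1 hx with hx | hx
        · rw [hFM x hx]
          exact ⟨(hM.2 x hx).1, fun z hz => Finset.mem_union_left _ ((hM.2 x hx).2 z hz)⟩
        · rw [hFT x hx]
          obtain ⟨ha, hb⟩ := Finset.mem_inter.1 (hg ⟨x, hx⟩)
          exact ⟨ha, (Finset.mem_filter.1 hb).2⟩
    have := hmax _ F Finset.subset_union_left (Finset.union_subset hMB hTB) hF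
    obtain ⟨x, hx⟩ := hT
    have hxM : x ∈ M := this ▸ Finset.mem_union_right M hx
    exact Finset.disjoint_left.1 hTM hx hxM

open Classical in
/-- If every set of elements of `X` is offered at least twice as many elements of `Y`, then every
`x₀` lies in a closed set of logarithmic radius. -/
theorem exists_closed_matching (N : X → Finset Y) (ball : ℕ → Finset X) (x₀ : X) (m : ℕ)
    (hratio : ∀ A : Finset X, 2 * A.card ≤ (A.biUnion N).card)
    (hmono : ∀ t, ball t ⊆ ball (t + 1)) (h0 : x₀ ∈ ball 0)
    (hstep : ∀ t, ∀ x ∈ ball t, ∀ y ∈ N x, ∀ x', y ∈ N x' → x' ∈ ball (t + 1))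
    (hm : (ball m).card < 2 ^ m) :
    ∃ S f, S ⊆ ball m ∧ x₀ ∈ S ∧ IsClosedMatching N S f := by
  have hmono' : ∀ s t, s ≤ t → ball s ⊆ ball t := fun s t hst => monotone_nat_of_le_succ hmono hst
  obtain ⟨y₀, -⟩ : ∃ y, y ∈ N x₀ := by
    have := hratio {x₀}
    rw [Finset.singleton_biUnion, Finset.card_singleton] at this
    exact Finset.card_pos.1 (by omega)
  let cand : Finset (Finset X) :=
    (ball m).powerset.filter fun M => ∃ f, IsClosedMatching N M f
  have hcand : cand.Nonempty :=
    ⟨∅, Finset.mem_filter.2 ⟨Finset.empty_mem_powerset _, fun _ => y₀, by simp [IsClosedMatching]⟩⟩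
  obtain ⟨M, hMc, hMmax⟩ := cand.exists_max_image Finset.card hcand
  obtain ⟨hMB, f, hf⟩ := Finset.mem_filter.1 hMc
  rw [Finset.mem_powerset] at hMB
  have hmax : ∀ M' g, M ⊆ M' → M' ⊆ ball m → IsClosedMatching N M' g → M' = M :=
    fun M' g h1 h2 h3 => (Finset.eq_of_subset_of_card_le h1 (hMmax M'
      (Finset.mem_filter.2 ⟨Finset.mem_powerset.2 h2, g, h3⟩))).symm
  by_cases hx : x₀ ∈ M
  · exact ⟨M, f, hMB, hx, hf⟩
  exfalso
  have growth : ∀ t, t ≤ m → 2 ^ t ≤ (ball t \ M).card := by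
    intro t
    induction t with
    | zero =>
      intro _
      exact Finset.card_pos.2 ⟨x₀, Finset.mem_sdiff.2 ⟨h0, hx⟩⟩
    | succ t ih =>
      intro ht
      have h1 := ih (by omega)
      have h2 := hratio (ball t \ M)
      have h3 := card_exclusive_lt hf hmax hMB (ball (t + 1) \ M)
        ⟨x₀, Finset.mem_sdiff.2 ⟨hmono' 0 _ (Nat.zero_le _) h0, hx⟩⟩
        (Finset.sdiff_subset.trans (hmono' _ _ ht)) Finset.sdiff_disjoint
      -- Whatever is offered to `ball t \ M` is offered only inside `ball (t + 1)`, hence is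
      -- exclusive to `ball (t + 1) \ M`. So 2·|ball t \ M| < |ball (t + 1) \ M|, which doubles too
      -- often for a ball of fewer than `2 ^ m` elements.
      have h4 : ((ball t \ M).biUnion N) ⊆ (((ball (t + 1) \ M).biUnion N).filter
          fun y => (∀ x, y ∈ N x → x ∈ M ∪ (ball (t + 1) \ M))) := by
        intro y hy
        obtain ⟨x, hxb, hxy⟩ := Finset.mem_biUnion.1 hy
        obtain ⟨hxb, hxM⟩ := Finset.mem_sdiff.1 hxb
        refine Finset.mem_filter.2 ⟨Finset.mem_biUnion.2 ⟨x, Finset.mem_sdiff.2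
          ⟨hmono t hxb, hxM⟩, hxy⟩, fun z hz => ?_⟩
        rw [Finset.union_sdiff_self_eq_union]
        exact Finset.mem_union_right _ (hstep t x hxb y hxy z hz)
      have h5 := Finset.card_le_card h4
      rw [pow_succ]
      omega
  have := growth m le_rfl
  have h2 := Finset.card_le_card (Finset.sdiff_subset (s := ball m) (t := M))
  omega

end Closed

/-! ### Orientations with outgoing and incoming edges at every branching -/

section Alternating

theorem even_card_of_involution {α : Type*} (F : Finset α) (f : α → α) (hf : ∀ x ∈ F, f x ∈ F)
    (hff : ∀ x ∈ F, f (f x) = x) (hne : ∀ x ∈ F, f x ≠ x) : Even F.card := by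
  have h : ∑ _x ∈ F, (1 : ZMod 2) = 0 :=
    Finset.sum_involution (fun x _ => f x) (fun _ _ => by decide) (fun x hx _ => hne x hx)
      (fun x hx => hf x hx) (fun x hx => hff x hx)
  rw [Finset.sum_const, nsmul_eq_mul, mul_one] at h
  exact (ZMod.natCast_eq_zero_iff_even).1 h

-- Alternately applying `a` and `b` runs along even cycles or two-way infinite paths, which can be
-- 2-colored. Each orbit of the two involutions consists of two cycles of `a * b`, interchanged by
-- both; comparing labels of the two cycles selects one of them.
open Equiv.Perm in
theorem exists_alternating_of_perm {α : Type*} [Encodable α] (a b : Equiv.Perm α)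
    (ha : ∀ x, a (a x) = x) (hb : ∀ x, b (b x) = x) (ha' : ∀ x, a x ≠ x) (hb' : ∀ x, b x ≠ x) :
    ∃ P : α → Prop, ∀ x, (P (a x) ↔ ¬P x) ∧ (P (b x) ↔ ¬P x) := by
  classical
  set r := a * b with hr
  have hrx : ∀ x, r x = a (b x) := fun x => rfl
  have hbr : ∀ x, b (r x) = r⁻¹ (b x) := by
    intro x
    rw [Equiv.Perm.eq_inv_iff_eq, hrx, hrx, hb, ha]
  have hbr' : ∀ (i : ℤ) x, b ((r ^ i) x) = (r ^ (-i)) (b x) := by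
    have key : b * r * b⁻¹ = r⁻¹ := by
      ext x
      simp only [Equiv.Perm.mul_apply]
      rw [hbr, show b (b⁻¹ x) = x from b.apply_symm_apply x]
    intro i x
    have := congrArg (fun p : Equiv.Perm α => p ^ i) key
    simp only [conj_zpow, inv_zpow'] at this
    have h2 := DFunLike.congr_fun this (b x)
    simp only [Equiv.Perm.mul_apply] at h2
    rw [show b⁻¹ (b x) = x from b.symm_apply_apply x] at h2
    simpa using h2
  -- Conjugation by `b` inverts `r`. If b x = r^i x, then the midpoint between x and b x yields a
  -- fixed point: of `b` if i is even, of `a` if i is odd.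
  have hnot : ∀ x, ¬ SameCycle r x (b x) := by
    rintro x ⟨i, hi⟩
    rcases Int.even_or_odd' i with ⟨j, rfl | rfl⟩
    · apply hb' ((r ^ j) x)
      rw [hbr', ← hi, ← Equiv.Perm.mul_apply, ← zpow_add]
      congr 2; ring
    · set y := (r ^ j) x with hy
      have h1 : b (r y) = y := by
        have : r y = (r ^ (j + 1)) x := by
          rw [hy, ← Equiv.Perm.mul_apply, ← zpow_one_add]; congr 2; ring
        rw [this, hbr', ← hi, ← Equiv.Perm.mul_apply, ← zpow_add, hy]
        congr 2; ring
      have h2 : b y = a (b y) := by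
        rw [← hrx]
        conv_lhs => rw [← h1]
        rw [hb]
      exact ha' _ h2.symm
  let q : α → ℕ := fun x => Encodable.encode (Quotient.out (Quotient.mk (SameCycle.setoid r) x))
  have hq : ∀ x y, q x = q y ↔ SameCycle r x y := by
    intro x y
    constructor
    · intro h
      have := Encodable.encode_injective h
      rw [Quotient.out_inj] at this
      exact Quotient.exact this
    · intro h
      have : Quotient.mk (SameCycle.setoid r) x = Quotient.mk (SameCycle.setoid r) y :=
        Quotient.sound h
      simp only [q, this]
  have hne : ∀ x, q x ≠ q (b x) := fun x h => hnot x ((hq _ _).1 h)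
  have h1 : ∀ x, q (a x) = q (b x) := by
    intro x
    rw [hq]
    have : a x = r (b x) := by rw [hrx, hb]
    rw [this]
    exact (Equiv.Perm.sameCycle_apply_left).2 (SameCycle.refl _ _)
  have h2 : ∀ x, q (b (a x)) = q x := by
    intro x
    rw [hq]
    have : x = r (b (a x)) := by rw [hrx, hb, ha]
    conv_rhs => rw [this]
    exact (Equiv.Perm.sameCycle_apply_right).2 (SameCycle.refl _ _)
  refine ⟨fun x => q x < q (b x), fun x => ⟨?_, ?_⟩⟩
  · show q (a x) < q (b (a x)) ↔ _
    rw [h1, h2]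
    have := hne x
    omega
  · show q (b x) < q (b (b x)) ↔ _
    rw [hb]
    have := hne x
    omega

/-- Greedy: as long as two related elements remain, pair such two, and pair arbitrarily afterwards.
A class with two elements is thus given a pair of its own. -/
theorem exists_involution_pairing {α : Type*} (K : α → α → Prop)
    (hsymm : ∀ x y, K x y → K y x) (htrans : ∀ x y z, K x y → K y z → K x z)
    (F : Finset α) (hF : Even F.card) :
    ∃ m : α → α, (∀ x ∈ F, m x ∈ F ∧ m (m x) = x ∧ m x ≠ x) ∧
      ∀ x ∈ F, ∀ y ∈ F, x ≠ y → K x y → ∃ z ∈ F, K x z ∧ K x (m z) := by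
  classical
  induction F using Finset.strongInduction with
  | H F ih =>
    rcases F.eq_empty_or_nonempty with rfl | hne
    · exact ⟨id, by simp⟩
    obtain ⟨a, ha, b, hb, hab, hK⟩ : ∃ a ∈ F, ∃ b ∈ F, a ≠ b ∧
        ((∃ x ∈ F, ∃ y ∈ F, x ≠ y ∧ K x y) → K a b) := by
      by_cases h : ∃ x ∈ F, ∃ y ∈ F, x ≠ y ∧ K x y
      · obtain ⟨x, hx, y, hy, hxy, h⟩ := h
        exact ⟨x, hx, y, hy, hxy, fun _ => h⟩
      · have : 1 < F.card := by
          have := Finset.card_pos.2 hne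
          obtain ⟨c, hc⟩ := hF
          omega
        obtain ⟨x, hx, y, hy, hxy⟩ := Finset.one_lt_card.1 this
        exact ⟨x, hx, y, hy, hxy, fun h' => absurd h' h⟩
    have hbF : b ∈ F.erase a := Finset.mem_erase.2 ⟨hab.symm, hb⟩
    have hc1 := Finset.card_erase_of_mem ha
    have hc2 := Finset.card_erase_of_mem hbF
    have hpos := Finset.card_pos.2 ⟨b, hbF⟩
    obtain ⟨m, h1, h2⟩ := ih ((F.erase a).erase b)
      ((Finset.erase_subset _ _).trans_ssubset (Finset.erase_ssubset ha))
      (by obtain ⟨c, hc⟩ := hF; exact ⟨c - 1, by omega⟩)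
    simp only [Finset.mem_erase] at h1 h2
    refine ⟨fun x => if x = a then b else if x = b then a else m x, ?_, ?_⟩
    · intro x hx
      by_cases hxa : x = a
      · simp [hxa, hb, hab.symm]
      by_cases hxb : x = b
      · simp [hxb, hab.symm, ha, hab]
      obtain ⟨⟨h3, h4, h5⟩, h6, h7⟩ := h1 x ⟨hxb, hxa, hx⟩
      simp [hxa, hxb, h3, h4, h5, h6, h7]
    · intro x hx y hy hxy hKxy
      have hKab := hK ⟨x, hx, y, hy, hxy, hKxy⟩
      by_cases hxa : K x a
      · exact ⟨a, ha, hxa, by simpa using htrans _ _ _ hxa hKab⟩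
      have hxb : ¬ K x b := fun h => hxa (htrans _ _ _ h (hsymm _ _ hKab))
      have hx1 : x ≠ a := by
        rintro rfl; exact hxb hKab
      have hx2 : x ≠ b := by
        rintro rfl; exact hxa (hsymm _ _ hKab)
      have hy1 : y ≠ a := by rintro rfl; exact hxa hKxy
      have hy2 : y ≠ b := by rintro rfl; exact hxb hKxy
      obtain ⟨z, ⟨hz1, hz2, hz⟩, h3, h4⟩ := h2 x ⟨hx2, hx1, hx⟩ y ⟨hy2, hy1, hy⟩ hxy hKxy
      exact ⟨z, hz, h3, by simpa [hz1, hz2] using h4⟩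

/-- The edges of `F` can be oriented so that every node with at least two half-edges in `F` has an
outgoing and an incoming one. -/
theorem exists_orientation (K : HalfEdge → HalfEdge → Prop)
    (hsymm : ∀ x y, K x y → K y x) (htrans : ∀ x y z, K x y → K y z → K x z)
    (F : Finset HalfEdge) (hswap : ∀ x ∈ F, x.swap ∈ F) (hne : ∀ x ∈ F, x.swap ≠ x) :
    ∃ P ⊆ F, (∀ x ∈ F, x.swap ∈ P ↔ x ∉ P) ∧
      ∀ x ∈ F, ∀ y ∈ F, x ≠ y → K x y → ∃ a b, K x a ∧ K x b ∧ a ∈ P ∧ b.swap ∈ P := by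
  classical
  have heven : Even F.card :=
    even_card_of_involution F Prod.swap hswap (fun x _ => Prod.swap_swap x) hne
  obtain ⟨m, hm1, hm2⟩ := exists_involution_pairing K hsymm htrans F heven
  have mk : ∀ f : HalfEdge → HalfEdge, (∀ x ∈ F, f x ∈ F ∧ f (f x) = x ∧ f x ≠ x) →
      ∃ p : Equiv.Perm F, ∀ x : F, (p x : HalfEdge) = f x := by
    intro f hf
    exact ⟨⟨fun x => ⟨f x, (hf x x.2).1⟩, fun x => ⟨f x, (hf x x.2).1⟩,
      fun x => Subtype.ext (hf x x.2).2.1, fun x => Subtype.ext (hf x x.2).2.1⟩, fun x => rfl⟩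
  obtain ⟨a, ha⟩ := mk m hm1
  obtain ⟨b, hb⟩ := mk Prod.swap fun x hx => ⟨hswap x hx, Prod.swap_swap x, hne x hx⟩
  -- Alternation under `b` makes `P` choose one half of each edge; alternation under `a` makes the
  -- two members of a pair within a class point in opposite directions.
  obtain ⟨P, hP⟩ := exists_alternating_of_perm a b
    (fun x => Subtype.ext (by rw [ha, ha]; exact (hm1 x x.2).2.1))
    (fun x => Subtype.ext (by rw [hb, hb, Prod.swap_swap]))
    (fun x h => (hm1 x x.2).2.2 (by rw [← ha, h]))
    (fun x h => hne x x.2 (by rw [← hb, h]))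
  have hmem : ∀ x : F, (x : HalfEdge) ∈ (Finset.univ.filter P).map (Function.Embedding.subtype _)
      ↔ P x := by
    intro x
    simp
  refine ⟨(Finset.univ.filter P).map (Function.Embedding.subtype _), ?_, ?_, ?_⟩
  · intro x hx
    obtain ⟨y, _, rfl⟩ := Finset.mem_map.1 hx
    exact y.2
  · intro x hx
    have h1 := (hP ⟨x, hx⟩).2
    rw [← hmem, ← hmem, hb] at h1
    exact h1
  · intro x hx y hy hxy hK
    obtain ⟨z, hz, h1, h2⟩ := hm2 x hx y hy hxy hK
    have h3 := (hP ⟨z, hz⟩).1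
    have h4 := (hP ⟨z, hz⟩).2
    have h5 := (hP (a ⟨z, hz⟩)).2
    rw [← hmem, ← hmem, ha] at h3
    rw [← hmem, ← hmem, hb] at h4
    rw [← hmem, ← hmem, hb, ha] at h5
    by_cases hzP : z ∈ (Finset.univ.filter P).map (Function.Embedding.subtype _)
    · exact ⟨z, m z, h1, h2, hzP, h5.2 fun h => (h3.1 h) hzP⟩
    · exact ⟨m z, z, h2, h1, h3.2 hzP, h4.2 hzP⟩

end Alternating

/-! ### Ruling sets and windows on the trails -/

/-- The number by which a half-edge is identified. -/
def code (h : HalfEdge) : ℕ := Nat.pair h.1 h.2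

theorem code_injective : Function.Injective code := by
  intro h g H
  have := Nat.pair_eq_pair.1 H
  exact Prod.ext this.1 this.2

/-- The half-edges that are left after `i` steps of a ruling set algorithm on the trails: in step
`i`, a half-edge whose code has bit `i` is deleted if one without this bit is at distance at most
`L` on its trail. -/
def Ruling (E : Incidence) (L : ℕ) : ℕ → HalfEdge → Prop
  | 0, _ => True
  | i + 1, h => Ruling E L i h ∧ ((code h).testBit i = true → ∀ j ≤ L,
      (Ruling E L i ((fwd E)^[j] h) → (code ((fwd E)^[j] h)).testBit i = true) ∧
      (Ruling E L i ((bwd E)^[j] h) → (code ((bwd E)^[j] h)).testBit i = true))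

theorem Ruling.mono {E : Incidence} {L i j : ℕ} {h : HalfEdge} (H : Ruling E L j h)
    (hij : i ≤ j) : Ruling E L i h := by
  induction hij with
  | refl => exact H
  | step _ ih => exact ih H.1

/-- Two distinct codes below `2 ^ β` differ in some bit i < β. If both half-edges had survived step
i, the one with the bit set would have been deleted because of the other. -/
theorem ruling_spaced {E : Incidence} (hE : IsIncidence E) {L β j : ℕ} {h : HalfEdge}
    (hv : E h h) (hj : j ≤ L) (hc : code h < 2 ^ β) (hc' : code ((fwd E)^[j] h) < 2 ^ β)
    (hr : Ruling E L β h) (hr' : Ruling E L β ((fwd E)^[j] h)) : (fwd E)^[j] h = h := by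
  by_contra hne
  have hcode : code ((fwd E)^[j] h) ≠ code h := fun H => hne (code_injective H)
  obtain ⟨i, hi⟩ := Nat.exists_testBit_ne_of_ne hcode
  have hiβ : i < β := by
    by_contra hge
    have hle : 2 ^ β ≤ 2 ^ i := Nat.pow_le_pow_right (by norm_num) (not_lt.1 hge)
    rw [Nat.testBit_lt_two_pow (hc.trans_le hle), Nat.testBit_lt_two_pow (hc'.trans_le hle)] at hi
    exact hi rfl
  have h1 := hr.mono (show i + 1 ≤ β from hiβ)
  have h2 := hr'.mono (show i + 1 ≤ β from hiβ)
  cases hb : (code h).testBit i with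
  | true =>
    have := (h1.2 hb j hj).1 h2.1
    exact hi (this.trans hb.symm)
  | false =>
    have hb' : (code ((fwd E)^[j] h)).testBit i = true := by
      cases hb'' : (code ((fwd E)^[j] h)).testBit i with
      | true => rfl
      | false => exact absurd (hb''.trans hb.symm) hi
    have back : (bwd E)^[j] ((fwd E)^[j] h) = h := by
      simpa using hE.iterate_bwd_fwd hv 0 j
    have := (h2.2 hb' j hj).2
    rw [back] at this
    rw [this h1.1] at hb
    exact absurd hb (by decide)

theorem ruling_dominating {E : Incidence} (hE : IsIncidence E) (L i : ℕ) {h : HalfEdge}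
    (hv : E h h) : ∃ j ≤ 2 * L * i, Ruling E L i ((bwd E)^[j] h) := by
  induction i generalizing h with
  | zero => exact ⟨0, by simp, trivial⟩
  | succ i ih =>
    -- The search starts `L` steps further back: if the half-edge found is deleted in this step, the
    -- one responsible, up to `L` steps away in either direction, still lies behind `h`.
    obtain ⟨j, hj, hr⟩ := ih (hE.iterate_bwd_valid hv L)
    rw [← Function.iterate_add_apply] at hr
    have hbound : ∀ j', j' ≤ j + L + L → j' ≤ 2 * L * (i + 1) := by
      intro j' hj'
      rw [Nat.mul_add]; omega
    by_cases hr' : Ruling E L (i + 1) ((bwd E)^[j + L] h)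
    · exact ⟨j + L, hbound _ (by omega), hr'⟩
    rw [Ruling, not_and] at hr'
    have hr'' := hr' hr
    push Not at hr''
    obtain ⟨-, j', hj', H⟩ := hr''
    by_cases H1 : Ruling E L i ((fwd E)^[j'] ((bwd E)^[j + L] h)) ∧
        ¬ (code ((fwd E)^[j'] ((bwd E)^[j + L] h))).testBit i = true
    · have e : (fwd E)^[j'] ((bwd E)^[j + L] h) = (bwd E)^[j + L - j'] h := by
        have := hE.iterate_fwd_bwd hv (j + L - j') j'
        rwa [Nat.sub_add_cancel (by omega)] at this
      rw [e] at H1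
      exact ⟨j + L - j', hbound _ (by omega), H1.1, fun hb => absurd hb H1.2⟩
    · have H2 := H fun h1 => by
        by_contra h2
        exact H1 ⟨h1, h2⟩
      rw [← Function.iterate_add_apply] at H2
      exact ⟨j' + (j + L), hbound _ (by omega), H2.1, fun hb => absurd hb H2.2⟩

/-- The distance to the last half-edge of the ruling set on the trail. -/
noncomputable def lag (E : Incidence) (L β : ℕ) (h : HalfEdge) : ℕ :=
  sInf {t | t ≤ 2 * L * β ∧ Ruling E L β ((bwd E)^[t] h)}

theorem lag_spec {E : Incidence} (hE : IsIncidence E) (L β : ℕ) {h : HalfEdge} (hv : E h h) :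
    lag E L β h ≤ 2 * L * β ∧ Ruling E L β ((bwd E)^[lag E L β h] h) :=
  Nat.sInf_mem (s := {t | t ≤ 2 * L * β ∧ Ruling E L β ((bwd E)^[t] h)})
    (ruling_dominating hE L β hv)

theorem lag_le {E : Incidence} {L β t : ℕ} {h : HalfEdge} (ht : t ≤ 2 * L * β)
    (hr : Ruling E L β ((bwd E)^[t] h)) : lag E L β h ≤ t :=
  Nat.sInf_le ⟨ht, hr⟩

theorem lag_eq_zero {E : Incidence} {L β : ℕ} {h : HalfEdge} (hr : Ruling E L β h) :
    lag E L β h = 0 :=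
  Nat.le_zero.1 (lag_le (Nat.zero_le _) hr)

theorem lag_fwd {E : Incidence} (hE : IsIncidence E) {L β : ℕ} {h : HalfEdge} (hv : E h h)
    (hr : ¬ Ruling E L β (fwd E h)) : lag E L β (fwd E h) = lag E L β h + 1 := by
  obtain ⟨h1, h2⟩ := lag_spec hE L β (hE.fwd_valid hv)
  obtain ⟨h3, h4⟩ := lag_spec hE L β hv
  cases ht : lag E L β (fwd E h) with
  | zero => rw [ht] at h2; exact absurd h2 hr
  | succ s =>
    rw [ht, Function.iterate_succ_apply, hE.bwd_fwd hv] at h2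
    have h5 : lag E L β h ≤ s := lag_le (by omega) h2
    have h6 : lag E L β (fwd E h) ≤ lag E L β h + 1 := lag_le (by omega) (by
      rw [Function.iterate_succ_apply, hE.bwd_fwd hv]; exact h4)
    omega

theorem lag_iterate_fwd {E : Incidence} (hE : IsIncidence E) {L β : ℕ} {h : HalfEdge}
    (hv : E h h) (j : ℕ) (hr : ∀ i, 1 ≤ i → i ≤ j → ¬ Ruling E L β ((fwd E)^[i] h)) :
    lag E L β ((fwd E)^[j] h) = lag E L β h + j := by
  induction j with
  | zero => rfl
  | succ j ih =>
    have h1 := hr (j + 1) (by omega) le_rfl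
    rw [Function.iterate_succ_apply'] at h1 ⊢
    rw [lag_fwd hE (hE.iterate_fwd_valid hv j) h1,
      ih fun i hi hij => hr i hi (by omega), Nat.add_assoc]

/-- A window of `L` consecutive half-edges of a trail starts with `h`. A window contains no
half-edge of the ruling set except possibly the first one, and no end of a trail. -/
def IsStart (E : Incidence) (L β : ℕ) (h : HalfEdge) : Prop :=
  L ∣ lag E L β h ∧ (∀ i, 1 ≤ i → i < L → ¬ Ruling E L β ((fwd E)^[i] h)) ∧
    ∀ i < L, mate E ((fwd E)^[i] h) ≠ (fwd E)^[i] h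

theorem IsStart.lag_iterate {E : Incidence} (hE : IsIncidence E) {L β i : ℕ} {h : HalfEdge}
    (hv : E h h) (H : IsStart E L β h) (hi : i < L) :
    lag E L β ((fwd E)^[i] h) = lag E L β h + i :=
  lag_iterate_fwd hE hv i fun i' h1 h2 => H.2.1 i' h1 (by omega)

/-- Windows are disjoint: inside a window the lag is a multiple of `L` plus the position, so a
half-edge determines its position modulo `L`, and walking back that far recovers the start. -/
theorem IsStart.eq_of_iterate_eq {E : Incidence} (hE : IsIncidence E) {L β i j : ℕ}
    {h g : HalfEdge} (hv : E h h) (gv : E g g) (H : IsStart E L β h) (H' : IsStart E L β g)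
    (hi : i < L) (hj : j < L) (heq : (fwd E)^[i] h = (fwd E)^[j] g) : i = j ∧ h = g := by
  have h1 := H.lag_iterate hE hv hi
  rw [heq, H'.lag_iterate hE gv hj] at h1
  obtain ⟨a, ha⟩ := H.1
  obtain ⟨b, hb⟩ := H'.1
  rw [ha, hb] at h1
  have hij : i = j := by
    have := congrArg (· % L) h1
    simpa [Nat.mod_eq_of_lt hi, Nat.mod_eq_of_lt hj] using this.symm
  subst hij
  have h2 := hE.iterate_bwd_fwd hv 0 i
  have h3 := hE.iterate_bwd_fwd gv 0 i
  rw [Nat.zero_add] at h2 h3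
  rw [heq, h3] at h2
  exact ⟨rfl, h2.symm⟩

/-- A trail soon reaches an end, or a window, or is a short cycle. -/
theorem exists_window {E : Incidence} (hE : IsIncidence E) {L β : ℕ} (hL : 0 < L)
    (hcode : ∀ h, E h h → code h < 2 ^ β) {h : HalfEdge} (hv : E h h) :
    (∃ i ≤ 3 * L, mate E ((fwd E)^[i] h) = (fwd E)^[i] h) ∨
    (∃ i ≤ 2 * L, IsStart E L β ((fwd E)^[i] h)) ∨
    ∃ p, 1 ≤ p ∧ p < L ∧ (fwd E)^[p] h = h := by
  by_cases hb : ∃ i ≤ 3 * L, mate E ((fwd E)^[i] h) = (fwd E)^[i] h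
  · exact Or.inl hb
  push Not at hb
  right
  by_cases hA : ∀ i, 1 ≤ i → i ≤ 2 * L → ¬ Ruling E L β ((fwd E)^[i] h)
  · left
    set t := lag E L β h with ht
    have hmod := Nat.mod_lt t hL
    -- Far from the ruling set a window starts at every multiple of `L`, so the lag is rounded up to
    -- the next one.
    obtain ⟨s, hs, hdvd⟩ : ∃ s < L, L ∣ t + s := by
      by_cases h0 : t % L = 0
      · exact ⟨0, hL, Nat.dvd_of_mod_eq_zero h0⟩
      · refine ⟨L - t % L, by omega, t / L + 1, ?_⟩
        have := Nat.div_add_mod t L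
        rw [Nat.mul_add]; omega
    refine ⟨s, by omega, ?_, ?_, ?_⟩
    · rw [lag_iterate_fwd hE hv s fun i h1 h2 => hA i h1 (by omega)]
      exact hdvd
    · intro i h1 h2
      rw [← Function.iterate_add_apply]
      exact hA _ (by omega) (by omega)
    · intro i hi
      rw [← Function.iterate_add_apply]
      exact hb _ (by omega)
  · push Not at hA
    obtain ⟨j, hj1, hj2, hr⟩ := hA
    by_cases hB : ∀ i, 1 ≤ i → i < L → ¬ Ruling E L β ((fwd E)^[i] ((fwd E)^[j] h))
    · left
      refine ⟨j, hj2, ?_, hB, ?_⟩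
      · rw [lag_eq_zero hr]; exact dvd_zero L
      · intro i hi
        rw [← Function.iterate_add_apply]
        exact hb _ (by omega)
    -- Two members of the ruling set at distance less than `L` must coincide, so the trail is a
    -- cycle of that length; the cycle is then pulled back from the `j`-th half-edge to `h`.
    · right
      push Not at hB
      obtain ⟨i, hi1, hi2, hr'⟩ := hB
      have hv' := hE.iterate_fwd_valid hv j
      have := ruling_spaced hE hv' hi2.le (hcode _ hv') (hcode _ (hE.iterate_fwd_valid hv' i)) hr hr'
      refine ⟨i, hi1, hi2, ?_⟩
      rw [← Function.iterate_add_apply] at this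
      have h2 := congrArg (bwd E)^[j] this
      rw [hE.iterate_bwd_fwd hv i j] at h2
      rw [h2]
      simpa using hE.iterate_bwd_fwd hv 0 j

/-! ### Locality of ruling sets and windows -/

section Locality

variable {E E' : Incidence}

theorem Agree.iterate_fwd_eq (hE : IsIncidence E) {r : ℕ} {h : HalfEdge} (hv : E h h) (j : ℕ)
    (A : Agree E E' r h) (hr : 2 * j ≤ r) : (fwd E)^[j] h = (fwd E')^[j] h := by
  induction j with
  | zero => rfl
  | succ j ih =>
    rw [Function.iterate_succ_apply', Function.iterate_succ_apply', ← ih (by omega)]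
    exact Agree.fwd_eq (r := 0) (A.at (hE.near_iterate_fwd hv j) (by omega))

theorem Agree.iterate_bwd_eq (hE : IsIncidence E) {r : ℕ} {h : HalfEdge} (hv : E h h) (j : ℕ)
    (A : Agree E E' r h) (hr : 2 * j ≤ r) : (bwd E)^[j] h = (bwd E')^[j] h := by
  induction j with
  | zero => rfl
  | succ j ih =>
    rw [Function.iterate_succ_apply', Function.iterate_succ_apply', ← ih (by omega)]
    exact Agree.bwd_eq (r := 0) (A.at (hE.near_iterate_bwd hv j) (by omega))

/-- Each of the `i` steps looks `L` half-edges along the trail, and a step of a trail costs two in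
`Near`. -/
theorem Agree.ruling_iff (hE : IsIncidence E) {L i : ℕ} {h : HalfEdge} (hv : E h h)
    (A : Agree E E' (2 * L * i) h) : Ruling E L i h ↔ Ruling E' L i h := by
  induction i generalizing h with
  | zero => exact Iff.rfl
  | succ i ih =>
    rw [Nat.mul_add, Nat.mul_one] at A
    have h1 := ih hv (A.mono (by omega))
    have h2 : ∀ j ≤ L, (fwd E)^[j] h = (fwd E')^[j] h ∧
        (Ruling E L i ((fwd E)^[j] h) ↔ Ruling E' L i ((fwd E)^[j] h)) := fun j hj =>
      ⟨A.iterate_fwd_eq hE hv j (by omega), ih (hE.iterate_fwd_valid hv j)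
        (A.at (hE.near_iterate_fwd hv j) (by omega))⟩
    have h3 : ∀ j ≤ L, (bwd E)^[j] h = (bwd E')^[j] h ∧
        (Ruling E L i ((bwd E)^[j] h) ↔ Ruling E' L i ((bwd E)^[j] h)) := fun j hj =>
      ⟨A.iterate_bwd_eq hE hv j (by omega), ih (hE.iterate_bwd_valid hv j)
        (A.at (hE.near_iterate_bwd hv j) (by omega))⟩
    rw [Ruling, Ruling, h1]
    refine and_congr_right' (imp_congr_right fun _ => forall₂_congr fun j hj => ?_)
    rw [← (h2 j hj).1, ← (h3 j hj).1, (h2 j hj).2, (h3 j hj).2]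

theorem Agree.lag_eq (hE : IsIncidence E) {L β : ℕ} {h : HalfEdge} (hv : E h h)
    (A : Agree E E' (6 * (L * β)) h) : lag E L β h = lag E' L β h := by
  rw [lag, lag]
  congr 1
  ext t
  refine and_congr_right fun ht => ?_
  rw [Nat.mul_assoc] at ht
  rw [← A.iterate_bwd_eq hE hv t (by omega)]
  exact Agree.ruling_iff hE (hE.iterate_bwd_valid hv t)
    (A.at (hE.near_iterate_bwd hv t) (by rw [Nat.mul_assoc]; omega))

theorem Agree.isStart_iff (hE : IsIncidence E) {L β : ℕ} {h : HalfEdge} (hv : E h h)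
    (A : Agree E E' (6 * (L * β) + 2 * L) h) : IsStart E L β h ↔ IsStart E' L β h := by
  rw [IsStart, IsStart, Agree.lag_eq hE hv (A.mono (by omega))]
  refine and_congr_right' (and_congr ?_ ?_)
  · refine forall₃_congr fun i _ hi => ?_
    rw [← A.iterate_fwd_eq hE hv i (by omega)]
    exact not_congr (Agree.ruling_iff hE (hE.iterate_fwd_valid hv i)
      (A.at (hE.near_iterate_fwd hv i) (by rw [Nat.mul_assoc]; omega)))
  · refine forall₂_congr fun i hi => ?_
    rw [← A.iterate_fwd_eq hE hv i (by omega)]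
    have : Agree E E' 0 ((fwd E)^[i] h) := A.at (hE.near_iterate_fwd hv i) (by omega)
    rw [this.mate_eq]

end Locality

/-! ### Canonical choices and the cutting of trails -/

section LeastCode

open Classical in
/-- The member of a family of finite sets that comes first in an enumeration of all of them. -/
noncomputable def leastCode (𝒱 : Set (Finset HalfEdge)) : Finset HalfEdge :=
  if h : 𝒱.Nonempty then Function.argminOn Encodable.encode 𝒱 h else ∅

theorem leastCode_mem {𝒱 : Set (Finset HalfEdge)} (h : 𝒱.Nonempty) : leastCode 𝒱 ∈ 𝒱 := by
  rw [leastCode, dif_pos h]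
  exact Function.argminOn_mem _ _ _

theorem leastCode_le {𝒱 : Set (Finset HalfEdge)} {Q : Finset HalfEdge} (hQ : Q ∈ 𝒱) :
    Encodable.encode (leastCode 𝒱) ≤ Encodable.encode Q := by
  rw [leastCode, dif_pos ⟨Q, hQ⟩]
  exact Function.argminOn_le Encodable.encode 𝒱 hQ

/-- This is what makes neighboring choices compatible: the least element of a larger family is also
chosen by every subfamily that contains it. -/
theorem leastCode_eq_of_subset {𝒱 𝒲 : Set (Finset HalfEdge)} (h : 𝒱 ⊆ 𝒲)
    (hm : leastCode 𝒲 ∈ 𝒱) : leastCode 𝒱 = leastCode 𝒲 :=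
  Encodable.encode_injective
    (le_antisymm (leastCode_le hm) (leastCode_le (h (leastCode_mem ⟨_, hm⟩))))

theorem leastCode_mem_of_mem {𝒱 : Set (Finset HalfEdge)} {g : HalfEdge}
    (hg : g ∈ leastCode 𝒱) : leastCode 𝒱 ∈ 𝒱 := by
  by_cases h : 𝒱.Nonempty
  · exact leastCode_mem h
  · rw [leastCode, dif_neg h] at hg
    exact absurd hg (Finset.notMem_empty g)

end LeastCode

/-- A set of at most one half-edge per node that meets all the windows passing through the nodes
of its members. -/
structure IsCutSet (E : Incidence) (L β ρ : ℕ) (Q : Finset HalfEdge) : Prop where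
  unique : ∀ g ∈ Q, ∀ g' ∈ Q, E g g' → g = g'
  hits : ∀ g ∈ Q, ∀ x, Near E (2 * L + 1) g x → IsStart E L β x →
    ∀ i < L, E g ((fwd E)^[i] x) → ∃ j < L, (fwd E)^[j] x ∈ Q
  near : ∀ g ∈ Q, ∀ g' ∈ Q, Near E ρ g g'

/-- The half-edges at which the trails are cut. -/
def IsCut (E : Incidence) (L β ρ : ℕ) (h : HalfEdge) : Prop :=
  h ∈ leastCode {Q | IsCutSet E L β ρ Q ∧ ∃ g ∈ Q, E h g}

theorem IsCut.eq {E : Incidence} {L β ρ : ℕ} (hE : IsIncidence E) {h g : HalfEdge}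
    (H : IsCut E L β ρ h) (H' : IsCut E L β ρ g) (hg : E h g) : h = g := by
  have : {Q | IsCutSet E L β ρ Q ∧ ∃ f ∈ Q, E g f} = {Q | IsCutSet E L β ρ Q ∧ ∃ f ∈ Q, E h f} := by
    ext Q
    refine and_congr_right' (exists_congr fun f => and_congr_right' ?_)
    exact ⟨hE.trans hg, hE.trans (hE.symm hg)⟩
  rw [IsCut, this] at H'
  exact (leastCode_mem_of_mem H).1.unique _ H _ H' hg

/-- Take the least cut set that touches any node on the window. It hits the window at some
half-edge, and there it is also the least among the cut sets touching that node, so this half-edge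
is really cut. -/
theorem exists_isCut_of_exists_isCutSet {E : Incidence} {L β ρ : ℕ} (hE : IsIncidence E)
    {x : HalfEdge} (hv : E x x) (hx : IsStart E L β x)
    (hQ : ∃ Q, IsCutSet E L β ρ Q ∧ ∃ i < L, (fwd E)^[i] x ∈ Q) :
    ∃ i < L, IsCut E L β ρ ((fwd E)^[i] x) := by
  set 𝒲 : Set (Finset HalfEdge) :=
    {Q | IsCutSet E L β ρ Q ∧ ∃ i < L, ∃ g ∈ Q, E ((fwd E)^[i] x) g} with h𝒲
  have hne : 𝒲.Nonempty := by
    obtain ⟨Q, h1, i, hi, h2⟩ := hQ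
    exact ⟨Q, h1, i, hi, _, h2, hE.iterate_fwd_valid hv i⟩
  obtain ⟨h1, i, hi, g, hg, hig⟩ := leastCode_mem hne
  have hn : Near E (2 * L + 1) g x :=
    hE.near_symm (((hE.near_iterate_fwd hv i).rel hig).mono (by omega))
  obtain ⟨j, hj, hjQ⟩ := h1.hits g hg x hn hx i hi (hE.symm hig)
  refine ⟨j, hj, ?_⟩
  rw [IsCut, leastCode_eq_of_subset (𝒲 := 𝒲)]
  · exact hjQ
  · rintro Q ⟨h2, f, hf, hjf⟩
    exact ⟨h2, j, hj, f, hf, hjf⟩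
  · exact ⟨h1, _, hjQ, hE.iterate_fwd_valid hv j⟩

section Existence

variable {E : Incidence} {k β : ℕ}

-- Double counting: disjoint windows of `4 * k` half-edges each, against classes of at most `2 * k`
-- half-edges.
open Classical in
theorem two_mul_card_le_card_classes (hE : IsIncidence E) (hk : 0 < k)
    (hsize : ∀ h, {g | E h g}.ncard ≤ 2 * k)
    (A : Finset {x // E x x ∧ IsStart E (4 * k) β x}) :
    2 * A.card ≤ (A.biUnion fun x => (Finset.range (4 * k)).image
      fun i => {g | E ((fwd E)^[i] x.1) g}).card := by
  set B := A.biUnion fun x => (Finset.range (4 * k)).image fun i => {g | E ((fwd E)^[i] x.1) g}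
  have h := Finset.card_le_mul_card_image_of_maps_to (s := A ×ˢ Finset.range (4 * k)) (t := B)
    (f := fun p => {g | E ((fwd E)^[p.2] p.1.1) g}) (fun p hp => by
      rw [Finset.mem_product] at hp
      exact Finset.mem_biUnion.2 ⟨p.1, hp.1, Finset.mem_image.2 ⟨p.2, hp.2, rfl⟩⟩) (2 * k) (by
      intro C hCB
      have himg : ((A ×ˢ Finset.range (4 * k)).filter
          fun p => {g | E ((fwd E)^[p.2] p.1.1) g} = C).card ≤ C.ncard := by
        by_cases hC : ((A ×ˢ Finset.range (4 * k)).filter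
            fun p => {g | E ((fwd E)^[p.2] p.1.1) g} = C).Nonempty
        · obtain ⟨p, hp⟩ := hC
          have hfin : C.Finite := by
            rw [← (Finset.mem_filter.1 hp).2]; exact hE.finite _
          rw [← Set.ncard_coe_finset]
          refine Set.ncard_le_ncard_of_injOn (fun p => (fwd E)^[p.2] p.1.1) ?_ ?_ hfin
          · intro q hq
            rw [Finset.mem_coe, Finset.mem_filter] at hq
            rw [← hq.2]
            exact hE.iterate_fwd_valid q.1.2.1 _
          · intro q hq q' hq' heq
            rw [Finset.mem_coe, Finset.mem_filter, Finset.mem_product, Finset.mem_range] at hq hq'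
            obtain ⟨h1, h2⟩ := q.1.2.2.eq_of_iterate_eq hE q.1.2.1 q'.1.2.1 q'.1.2.2 hq.1.2
              hq'.1.2 heq
            exact Prod.ext (Subtype.ext h2) h1
        · rw [Finset.not_nonempty_iff_eq_empty.1 hC]; simp
      refine himg.trans ?_
      obtain ⟨x, _, hx⟩ := Finset.mem_biUnion.1 hCB
      obtain ⟨i, _, rfl⟩ := Finset.mem_image.1 hx
      exact hsize _)
  rw [Finset.card_product, Finset.card_range] at h
  have h2 : (2 * k) * (2 * A.card) ≤ (2 * k) * B.card := by
    calc (2 * k) * (2 * A.card) = A.card * (4 * k) := by ring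
      _ ≤ _ := h
  exact Nat.le_of_mul_le_mul_left h2 (by omega)

-- A closed matching of windows to classes yields a cut set: injectivity gives one cut per node, and
-- closedness says that all windows through a chosen node are themselves cut. Going from a window to
-- one sharing a class takes at most 8k + 1 + 8k steps, whence `16 * k + 1`; there are β rounds of
-- growth, `8 * k` steps lead to the chosen half-edge, and the diameter is twice the radius.
open Classical in
theorem exists_isCutSet (hE : IsIncidence E) (hk : 0 < k)
    (hsize : ∀ h, {g | E h g}.ncard ≤ 2 * k) (hfin : {h | E h h}.Finite)
    (hcard : {h | E h h}.ncard < 2 ^ β) {x : HalfEdge} (hv : E x x)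
    (hx : IsStart E (4 * k) β x) {ρ : ℕ} (hρ : 2 * (β * (16 * k + 1) + 8 * k) ≤ ρ) :
    ∃ Q, IsCutSet E (4 * k) β ρ Q ∧ ∃ i < 4 * k, (fwd E)^[i] x ∈ Q := by
  set X := {x // E x x ∧ IsStart E (4 * k) β x}
  have hXfin : Finite X := (hfin.subset (fun x hx => hx.1) : {x | E x x ∧ IsStart E (4 * k) β x}.Finite)
  have : Fintype X := Fintype.ofFinite X
  have hXcard : Fintype.card X < 2 ^ β := by
    refine lt_of_le_of_lt ?_ hcard
    rw [← Nat.card_eq_fintype_card]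
    exact Set.ncard_le_ncard (s := {x | E x x ∧ IsStart E (4 * k) β x}) (fun x hx => hx.1) hfin
  let N : X → Finset (Set HalfEdge) := fun x => (Finset.range (4 * k)).image
      fun i => {g | E ((fwd E)^[i] x.1) g}
  let ball : ℕ → Finset X := fun t => Finset.univ.filter fun z => Near E (t * (16 * k + 1)) x z.1
  obtain ⟨S, f, hSb, hxS, hSf⟩ := exists_closed_matching N ball ⟨x, hv, hx⟩ β
    (two_mul_card_le_card_classes hE hk hsize)
    (fun t z hz => by
      simp only [ball, Finset.mem_filter, Finset.mem_univ, true_and] at hz ⊢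
      exact hz.mono (Nat.mul_le_mul_right _ (Nat.le_succ t)))
    (by simp only [ball, Finset.mem_filter, Finset.mem_univ, true_and]
        rw [Nat.zero_mul]; exact Near.refl E x)
    (fun t z hz y hy z' hy' => by
      simp only [ball, Finset.mem_filter, Finset.mem_univ, true_and] at hz ⊢
      obtain ⟨i, hi, rfl⟩ := Finset.mem_image.1 hy
      obtain ⟨j, hj, hij⟩ := Finset.mem_image.1 hy'
      rw [Finset.mem_range] at hi hj
      have hrel : E ((fwd E)^[i] z.1) ((fwd E)^[j] z'.1) := by
        have : (fwd E)^[j] z'.1 ∈ {g | E ((fwd E)^[j] z'.1) g} := hE.iterate_fwd_valid z'.2.1 j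
        rw [hij] at this
        exact this
      exact ((hz.trans ((hE.near_iterate_fwd z.2.1 i).rel hrel)).trans
        (hE.near_symm (hE.near_iterate_fwd z'.2.1 j))).mono (by
          have : (t + 1) * (16 * k + 1) = t * (16 * k + 1) + (16 * k + 1) := by ring
          omega))
    ((Finset.card_le_univ _).trans_lt hXcard)
  have hch : ∀ z : X, ∃ i, z ∈ S → i < 4 * k ∧ {g | E ((fwd E)^[i] z.1) g} = f z := by
    intro z
    by_cases hz : z ∈ S
    · obtain ⟨i, hi, h⟩ := Finset.mem_image.1 (hSf.2 z hz).1
      exact ⟨i, fun _ => ⟨Finset.mem_range.1 hi, h⟩⟩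
    · exact ⟨0, fun h => absurd h hz⟩
  choose i hi using hch
  have hmem : ∀ z ∈ S, (fwd E)^[i z] z.1 ∈ f z := by
    intro z hz
    rw [← (hi z hz).2]
    exact hE.iterate_fwd_valid z.2.1 _
  have hnear : ∀ z ∈ S, Near E (β * (16 * k + 1) + 8 * k) x ((fwd E)^[i z] z.1) := by
    intro z hz
    have h1 := hSb hz
    simp only [ball, Finset.mem_filter, Finset.mem_univ, true_and] at h1
    have h2 := (hi z hz).1
    exact (h1.trans (hE.near_iterate_fwd z.2.1 (i z))).mono (by omega)
  refine ⟨S.image fun z => (fwd E)^[i z] z.1, ⟨?_, ?_, ?_⟩, i ⟨x, hv, hx⟩, (hi _ hxS).1,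
    Finset.mem_image.2 ⟨_, hxS, rfl⟩⟩
  · intro g hg g' hg' hgg
    obtain ⟨z, hz, rfl⟩ := Finset.mem_image.1 hg
    obtain ⟨z', hz', rfl⟩ := Finset.mem_image.1 hg'
    have : z = z' := hSf.1 hz hz' (by
      rw [← (hi z hz).2, ← (hi z' hz').2]
      exact (hE.class_eq hgg).symm)
    rw [this]
  · intro g hg y hy hys j hj hgy
    obtain ⟨z, hz, rfl⟩ := Finset.mem_image.1 hg
    have hyv : E y y := hE.near_valid (hE.iterate_fwd_valid z.2.1 _) hy
    have : f z ∈ N ⟨y, hyv, hys⟩ := by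
      refine Finset.mem_image.2 ⟨j, Finset.mem_range.2 hj, ?_⟩
      rw [← (hi z hz).2]
      exact hE.class_eq hgy
    have hyS := (hSf.2 z hz).2 _ this
    exact ⟨i ⟨y, hyv, hys⟩, (hi _ hyS).1, Finset.mem_image.2 ⟨_, hyS, rfl⟩⟩
  · intro g hg g' hg'
    obtain ⟨z, hz, rfl⟩ := Finset.mem_image.1 hg
    obtain ⟨z', hz', rfl⟩ := Finset.mem_image.1 hg'
    exact ((hE.near_symm (hnear z hz)).trans (hnear z' hz')).mono (by omega)

end Existence

/-! ### Locality of the cuts -/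

section Locality

variable {E E' : Incidence}

/-- All conditions on `Q` are checked near its members: a window through the node of `g` starts
within `2 * L + 1` of `g`, and whether it is a window is a local question. -/
theorem Agree.isCutSet_iff (hE : IsIncidence E) {L β ρ : ℕ} {h : HalfEdge} (hv : E h h)
    (A : Agree E E' (2 * ρ + 6 * (L * β) + 4 * L + 2) h) {Q : Finset HalfEdge}
    (hQ : ∀ g ∈ Q, Near E (ρ + 1) h g) : IsCutSet E L β ρ Q ↔ IsCutSet E' L β ρ Q := by
  have hA : ∀ g ∈ Q, Agree E E' (ρ + 6 * (L * β) + 4 * L + 1) g := fun g hg =>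
    A.at (hQ g hg) (by omega)
  have h1 : (∀ g ∈ Q, ∀ g' ∈ Q, E g g' → g = g') ↔ (∀ g ∈ Q, ∀ g' ∈ Q, E' g g' → g = g') :=
    forall₂_congr fun g hg => forall₂_congr fun g' _ => by rw [(hA g hg).rel g']
  have h2 : (∀ g ∈ Q, ∀ g' ∈ Q, Near E ρ g g') ↔ (∀ g ∈ Q, ∀ g' ∈ Q, Near E' ρ g g') :=
    forall₂_congr fun g hg => forall₂_congr fun g' _ =>
      ((hA g hg).mono (by omega)).near_iff g'
  have h3 : (∀ g ∈ Q, ∀ x, Near E (2 * L + 1) g x → IsStart E L β x →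
      ∀ i < L, E g ((fwd E)^[i] x) → ∃ j < L, (fwd E)^[j] x ∈ Q) ↔
      (∀ g ∈ Q, ∀ x, Near E' (2 * L + 1) g x → IsStart E' L β x →
      ∀ i < L, E' g ((fwd E')^[i] x) → ∃ j < L, (fwd E')^[j] x ∈ Q) := by
    refine forall₂_congr fun g hg => forall_congr' fun x => ?_
    rw [← ((hA g hg).mono (show 2 * L + 1 ≤ _ by omega)).near_iff x]
    refine imp_congr_right fun hx => ?_
    have hxv : E x x := hE.near_valid (hE.near_valid hv (hQ g hg)) hx
    have hAx : Agree E E' (6 * (L * β) + 2 * L) x := (hA g hg).at hx (by omega)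
    rw [← Agree.isStart_iff hE hxv hAx]
    refine imp_congr_right fun _ => forall₂_congr fun i hi => ?_
    rw [← hAx.iterate_fwd_eq hE hxv i (by omega), (hA g hg).rel]
    refine imp_congr_right fun _ => exists_congr fun j => and_congr_right fun hj => ?_
    rw [← hAx.iterate_fwd_eq hE hxv j (by omega)]
  exact ⟨fun H => ⟨h1.1 H.unique, h3.1 H.hits, h2.1 H.near⟩,
    fun H => ⟨h1.2 H.unique, h3.2 H.hits, h2.2 H.near⟩⟩

theorem Agree.isCut_iff (hE : IsIncidence E) {L β ρ : ℕ} {h : HalfEdge} (hv : E h h)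
    (A : Agree E E' (2 * ρ + 6 * (L * β) + 4 * L + 2) h) :
    IsCut E L β ρ h ↔ IsCut E' L β ρ h := by
  rw [IsCut, IsCut]
  have : {Q | IsCutSet E L β ρ Q ∧ ∃ g ∈ Q, E h g} = {Q | IsCutSet E' L β ρ Q ∧ ∃ g ∈ Q, E' h g} := by
    ext Q
    constructor
    · rintro ⟨H, g, hg, hhg⟩
      refine ⟨(Agree.isCutSet_iff hE hv A fun f hf => ?_).1 H, g, hg, (A.rel g).1 hhg⟩
      rw [Nat.add_comm]
      exact ((Near.refl E h).rel hhg).trans (H.near g hg f hf)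
    · rintro ⟨H, g, hg, hhg⟩
      have hhg' := (A.rel g).2 hhg
      have hng : Near E 1 h g := (Near.refl E h).rel hhg'
      refine ⟨(Agree.isCutSet_iff hE hv A fun f hf => ?_).2 H, g, hg, hhg'⟩
      rw [Nat.add_comm]
      exact hng.trans ((Agree.near_iff (A.at hng (by omega)) f).2 (H.near g hg f hf))
  rw [this]

end Locality

/-! ### Anchors: ends and cycles within reach -/

/-- A trail that leaves through `h` can go on with `g`, where `K` tells which half-edges are
joined. -/
def Succ (K : Incidence) (h g : HalfEdge) : Prop := K h.swap g ∧ g ≠ h.swap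

/-- A trail that leaves through `h` can reach `g` in `n` steps. -/
def Reach (K : Incidence) : ℕ → HalfEdge → HalfEdge → Prop
  | 0, h, g => g = h
  | n + 1, h, g => ∃ f, Reach K n h f ∧ Succ K f g

/-- At every node touched by the set `F` of edges, except where `h` is, there is either nothing else
or a second half-edge in `F`. -/
structure IsAnchor (K : Incidence) (h : HalfEdge) (F : Finset HalfEdge) : Prop where
  swap : ∀ p ∈ F, p.swap ∈ F
  mem : h ∈ F
  good : ∀ p ∈ F, p ≠ h → (∀ q, K p q → q = p) ∨ ∃ q ∈ F, q ≠ p ∧ K p q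

section Tree

variable {E K : Incidence}

theorem Reach.near (hKE : ∀ h g, K h g → E h g) {n : ℕ} {h g : HalfEdge}
    (H : Reach K n h g) : Near E (2 * n) h g := by
  induction n generalizing g with
  | zero => exact H
  | succ n ih =>
    obtain ⟨f, h1, h2⟩ := H
    exact ((ih h1).swap.rel (hKE _ _ h2.1)).mono (by omega)

theorem Reach.cons {n : ℕ} {h g f : HalfEdge} (hg : Succ K h g) (H : Reach K n g f) :
    Reach K (n + 1) h f := by
  induction n generalizing f with
  | zero => cases H; exact ⟨h, rfl, hg⟩
  | succ n ih =>
    obtain ⟨f', h1, h2⟩ := H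
    exact ⟨f', ih h1, h2⟩

theorem Reach.trans {n m : ℕ} {h g f : HalfEdge} (H : Reach K n h g) (H' : Reach K m g f) :
    Reach K (n + m) h f := by
  induction m generalizing f with
  | zero => cases H'; exact H
  | succ m ih =>
    obtain ⟨f', h1, h2⟩ := H'
    exact ⟨f', ih h1, h2⟩

-- `F` consists of the edges of the trail. At an inner node the arriving and the departing half-edge
-- are partners; only the two extremities lack one.
open Classical in
theorem Reach.exists_support (hKE : ∀ h g, K h g → E h g)
    (hK : ∀ h g, K h g → K g h) {n : ℕ} {h q : HalfEdge} (H : Reach K n h q) :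
    ∃ F : Finset HalfEdge, (∀ p ∈ F, p.swap ∈ F) ∧ h ∈ F ∧ q ∈ F ∧
      (∀ p ∈ F, Near E (2 * n + 1) h p) ∧
      ∀ p ∈ F, p ≠ h → p ≠ q.swap → ∃ p' ∈ F, p' ≠ p ∧ K p p' := by
  induction n generalizing q with
  | zero =>
    cases H
    refine ⟨{h, h.swap}, ?_, by simp, by simp, ?_, ?_⟩
    · intro p hp
      rcases Finset.mem_insert.1 hp with rfl | hp
      · simp
      · rw [Finset.mem_singleton.1 hp]; simp
    · intro p hp
      rcases Finset.mem_insert.1 hp with rfl | hp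
      · exact (Near.refl E p).succ
      · rw [Finset.mem_singleton.1 hp]; exact (Near.refl E h).swap
    · intro p hp h1 h2
      rcases Finset.mem_insert.1 hp with rfl | hp
      · exact absurd rfl h1
      · exact absurd (Finset.mem_singleton.1 hp) h2
  | succ n ih =>
    have Hn := H.near hKE
    obtain ⟨f, h1, h2⟩ := H
    obtain ⟨F, hs, hh, hf, hn, hgood⟩ := ih h1
    refine ⟨insert q (insert q.swap F), ?_, by simp [hh], by simp, ?_, ?_⟩
    · intro p hp
      simp only [Finset.mem_insert] at hp ⊢
      rcases hp with rfl | rfl | hp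
      · exact Or.inr (Or.inl rfl)
      · exact Or.inl (Prod.swap_swap q)
      · exact Or.inr (Or.inr (hs p hp))
    · intro p hp
      simp only [Finset.mem_insert] at hp
      rcases hp with rfl | rfl | hp
      · exact Hn.succ
      · exact Hn.swap
      · exact (hn p hp).mono (by omega)
    · intro p hp h3 h4
      simp only [Finset.mem_insert] at hp
      have hqcase : ∃ p' ∈ insert q (insert q.swap F), p' ≠ q ∧ K q p' :=
        ⟨f.swap, by simp [hs f hf], h2.2.symm, hK _ _ h2.1⟩
      rcases hp with rfl | rfl | hp
      · exact hqcase
      · exact absurd rfl h4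
      · by_cases h5 : p = f.swap
        · subst h5
          exact ⟨q, by simp, h2.2, h2.1⟩
        · obtain ⟨p', h6, h7⟩ := hgood p hp h3 h5
          exact ⟨p', by simp [h6], h7⟩

-- The union of the two trails: their last half-edges lie at the same joined node and are each
-- other's partners.
open Classical in
theorem exists_anchor_of_meeting (hKE : ∀ h g, K h g → E h g)
    (hK : ∀ h g, K h g → K g h) {n m r : ℕ} {h a b : HalfEdge} (ha : Reach K n h a)
    (hb : Reach K m h b) (hab : a ≠ b) (hKab : K a.swap b.swap) (hn : 2 * n + 1 ≤ r)
    (hm : 2 * m + 1 ≤ r) : ∃ F, IsAnchor K h F ∧ ∀ p ∈ F, Near E r h p := by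
  obtain ⟨F, hs, hh, hf, hnear, hgood⟩ := ha.exists_support hKE hK
  obtain ⟨F', hs', hh', hf', hnear', hgood'⟩ := hb.exists_support hKE hK
  have hne : a.swap ≠ b.swap := fun H => hab (Prod.swap_injective H)
  refine ⟨F ∪ F', ⟨?_, Finset.mem_union_left _ hh, ?_⟩, ?_⟩
  · intro p hp
    rcases Finset.mem_union.1 hp with hp | hp
    · exact Finset.mem_union_left _ (hs p hp)
    · exact Finset.mem_union_right _ (hs' p hp)
  · intro p hp hph
    right
    by_cases h1 : p = a.swap
    · exact ⟨b.swap, Finset.mem_union_right _ (hs' b hf'), by rw [h1]; exact hne.symm,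
        by rw [h1]; exact hKab⟩
    by_cases h2 : p = b.swap
    · exact ⟨a.swap, Finset.mem_union_left _ (hs a hf), by rw [h2]; exact hne,
        by rw [h2]; exact hK _ _ hKab⟩
    rcases Finset.mem_union.1 hp with hp | hp
    · obtain ⟨p', h3, h4⟩ := hgood p hp hph h1
      exact ⟨p', Finset.mem_union_left _ h3, h4⟩
    · obtain ⟨p', h3, h4⟩ := hgood' p hp hph h2
      exact ⟨p', Finset.mem_union_right _ h3, h4⟩
  · intro p hp
    rcases Finset.mem_union.1 hp with hp | hp
    · exact (hnear p hp).mono hn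
    · exact (hnear' p hp).mono hm

-- A tail followed by a closed trail: the half-edges `a.swap` and `g`, where the closed part begins
-- and ends, are each other's partners.
open Classical in
theorem exists_anchor_of_cycle (hKE : ∀ h g, K h g → E h g)
    (hK : ∀ h g, K h g → K g h) {n m r : ℕ} {h a g : HalfEdge} (ha : Reach K n h a)
    (hg : Succ K a g) (hga : Reach K m g a) (hr : 2 * (n + m) + 3 ≤ r) :
    ∃ F, IsAnchor K h F ∧ ∀ p ∈ F, Near E r h p := by
  have hhg : Near E (2 * (n + 1)) h g := Reach.near (K := K) hKE ⟨a, ha, hg⟩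
  obtain ⟨F, hs, hh, hf, hnear, hgood⟩ := ha.exists_support hKE hK
  obtain ⟨F', hs', hh', hf', hnear', hgood'⟩ := hga.exists_support hKE hK
  refine ⟨F ∪ F', ⟨?_, Finset.mem_union_left _ hh, ?_⟩, ?_⟩
  · intro p hp
    rcases Finset.mem_union.1 hp with hp | hp
    · exact Finset.mem_union_left _ (hs p hp)
    · exact Finset.mem_union_right _ (hs' p hp)
  · intro p hp hph
    right
    by_cases h1 : p = a.swap
    · exact ⟨g, Finset.mem_union_right _ hh', by rw [h1]; exact hg.2, by rw [h1]; exact hg.1⟩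
    by_cases h2 : p = g
    · exact ⟨a.swap, Finset.mem_union_left _ (hs a hf), by rw [h2]; exact hg.2.symm,
        by rw [h2]; exact hK _ _ hg.1⟩
    rcases Finset.mem_union.1 hp with hp | hp
    · obtain ⟨p', h3, h4⟩ := hgood p hp hph h1
      exact ⟨p', Finset.mem_union_left _ h3, h4⟩
    · obtain ⟨p', h3, h4⟩ := hgood' p hp h2 h1
      exact ⟨p', Finset.mem_union_right _ h3, h4⟩
  · intro p hp
    rcases Finset.mem_union.1 hp with hp | hp
    · exact (hnear p hp).mono (by omega)
    · exact (hhg.trans (hnear' p hp)).mono (by omega)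

open Classical in
theorem exists_anchor_of_succ (hKE : ∀ h g, K h g → E h g)
    (hK : ∀ h g, K h g → K g h) {r : ℕ} {h g : HalfEdge}
    (hg : Succ K h g) (H : ∃ F, IsAnchor K g F ∧ ∀ p ∈ F, Near E r g p) :
    ∃ F, IsAnchor K h F ∧ ∀ p ∈ F, Near E (r + 2) h p := by
  obtain ⟨F, hF, hn⟩ := H
  refine ⟨insert h (insert h.swap F), ⟨?_, by simp, ?_⟩, ?_⟩
  · intro p hp
    simp only [Finset.mem_insert] at hp ⊢
    rcases hp with rfl | rfl | hp
    · exact Or.inr (Or.inl rfl)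
    · exact Or.inl (Prod.swap_swap h)
    · exact Or.inr (Or.inr (hF.swap p hp))
  · intro p hp hph
    by_cases h1 : p = g
    · subst h1
      exact Or.inr ⟨h.swap, by simp, hg.2.symm, hK _ _ hg.1⟩
    by_cases h2 : p = h.swap
    · subst h2
      exact Or.inr ⟨g, by simp [hF.mem], hg.2, hg.1⟩
    simp only [Finset.mem_insert, hph, h2, false_or] at hp
    rcases hF.good p hp h1 with h3 | ⟨q, h3, h4⟩
    · exact Or.inl h3
    · exact Or.inr ⟨q, by simp [h3], h4⟩
  · intro p hp
    simp only [Finset.mem_insert] at hp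
    rcases hp with rfl | rfl | hp
    · exact (Near.refl E p).mono (by omega)
    · exact (Near.refl E h).swap.mono (by omega)
    · rw [Nat.add_comm]
      exact ((Near.refl E h).swap.rel (hKE _ _ hg.1)).trans (hn p hp)

theorem exists_anchor_of_reach (hKE : ∀ h g, K h g → E h g)
    (hK : ∀ h g, K h g → K g h) {n r : ℕ} {h g : HalfEdge} (hg : Reach K n h g)
    (H : ∃ F, IsAnchor K g F ∧ ∀ p ∈ F, Near E r g p) :
    ∃ F, IsAnchor K h F ∧ ∀ p ∈ F, Near E (r + 2 * n) h p := by
  induction n generalizing g r with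
  | zero => cases hg; exact H
  | succ n ih =>
    obtain ⟨f, h1, h2⟩ := hg
    have := ih h1 (exists_anchor_of_succ hKE hK h2 H)
    rwa [show r + 2 + 2 * n = r + 2 * (n + 1) by ring] at this

theorem exists_anchor_of_leaf {h : HalfEdge} (H : ∀ q, K h.swap q → q = h.swap) :
    ∃ F, IsAnchor K h F ∧ ∀ p ∈ F, Near E 1 h p := by
  refine ⟨{h, h.swap}, ⟨?_, by simp, ?_⟩, ?_⟩
  · intro p hp
    rcases Finset.mem_insert.1 hp with rfl | hp
    · simp
    · rw [Finset.mem_singleton.1 hp]; simp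
  · intro p hp hph
    simp only [Finset.mem_insert, hph, Finset.mem_singleton, false_or] at hp
    subst hp
    exact Or.inl H
  · intro p hp
    rcases Finset.mem_insert.1 hp with rfl | hp
    · exact (Near.refl E p).succ
    · rw [Finset.mem_singleton.1 hp]; exact (Near.refl E h).swap

/-- Going back from `d` along both branches, drop common half-edges until the predecessors differ.
There two trails from `h` meet, or one of them has returned to `a` and closes a cycle. -/
theorem exists_anchor_of_branches_meet (hKE : ∀ h g, K h g → E h g)
    (hK : ∀ h g, K h g → K g h) (hKt : ∀ h g f, K h g → K g f → K h f)
    {n n₁ n₂ N : ℕ} {h a g₁ g₂ d : HalfEdge}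
    (ha : Reach K n h a) (hg₁ : Succ K a g₁) (hg₂ : Succ K a g₂) (hne : g₁ ≠ g₂)
    (h₁ : Reach K n₁ g₁ d) (h₂ : Reach K n₂ g₂ d) (hn₁ : n₁ ≤ N) (hn₂ : n₂ ≤ N) :
    ∃ F, IsAnchor K h F ∧ ∀ p ∈ F, Near E (2 * (n + N) + 3) h p := by
  induction n₁ generalizing d n₂ with
  | zero =>
    cases h₁
    cases n₂ with
    | zero => exact absurd h₂ hne
    | succ s =>
      obtain ⟨q, hq, hqd⟩ := h₂
      by_cases hqa : q = a
      · subst hqa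
        exact exists_anchor_of_cycle hKE hK ha hg₂ hq (by omega)
      · exact exists_anchor_of_meeting hKE hK ha (ha.trans (hq.cons hg₂)) (Ne.symm hqa)
          (hKt _ _ _ hg₁.1 (hK _ _ hqd.1)) (by omega) (by omega)
  | succ s ih =>
    obtain ⟨q₁, hq₁, hqd₁⟩ := h₁
    cases n₂ with
    | zero =>
      cases h₂
      by_cases hqa : q₁ = a
      · subst hqa
        exact exists_anchor_of_cycle hKE hK ha hg₁ hq₁ (by omega)
      · exact exists_anchor_of_meeting hKE hK ha (ha.trans (hq₁.cons hg₁)) (Ne.symm hqa)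
          (hKt _ _ _ hg₂.1 (hK _ _ hqd₁.1)) (by omega) (by omega)
    | succ s' =>
      obtain ⟨q₂, hq₂, hqd₂⟩ := h₂
      by_cases hq : q₁ = q₂
      · subst hq
        exact ih hq₁ hq₂ (by omega) (by omega)
      · exact exists_anchor_of_meeting hKE hK (ha.trans (hq₁.cons hg₁))
          (ha.trans (hq₂.cons hg₂)) hq (hKt _ _ _ hqd₁.1 (hK _ _ hqd₂.1)) (by omega) (by omega)

open Classical in
/-- If trails branch at least every `ℓ` steps, then the trails from `h` either form a binary tree,
or contain an anchor. -/
theorem exists_anchor_or_tree (hE : IsIncidence E) (hKE : ∀ h g, K h g → E h g)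
    (hK : ∀ h g, K h g → K g h) (hKt : ∀ h g f, K h g → K g f → K h f) {ℓ : ℕ} (hℓ : 1 ≤ ℓ)
    (hdense : ∀ h, E h h → (∃ F, IsAnchor K h F ∧ ∀ p ∈ F, Near E (2 * ℓ + 1) h p) ∨
      ∃ n < ℓ, ∃ a g₁ g₂, Reach K n h a ∧ Succ K a g₁ ∧ Succ K a g₂ ∧ g₁ ≠ g₂)
    (m : ℕ) {h : HalfEdge} (hv : E h h) :
    (∃ F, IsAnchor K h F ∧ ∀ p ∈ F, Near E (2 * (m * ℓ) + 2 * ℓ + 1) h p) ∨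
      ∃ D : Finset HalfEdge, 2 ^ m ≤ D.card ∧ ∀ d ∈ D, ∃ n ≤ m * ℓ, Reach K n h d := by
  induction m generalizing h with
  | zero => exact Or.inr ⟨{h}, by simp, fun d hd => ⟨0, le_rfl.trans (Nat.zero_le _),
      Finset.mem_singleton.1 hd⟩⟩
  | succ m ih =>
    have hmul : (m + 1) * ℓ = m * ℓ + ℓ := by ring
    rcases hdense h hv with ⟨F, hF, hn⟩ | ⟨n, hn, a, g₁, g₂, ha, hg₁, hg₂, hne⟩
    · exact Or.inl ⟨F, hF, fun p hp => (hn p hp).mono (by omega)⟩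
    have branch : ∀ g, Succ K a g → (∃ F, IsAnchor K h F ∧ ∀ p ∈ F,
        Near E (2 * ((m + 1) * ℓ) + 2 * ℓ + 1) h p) ∨ ∃ D : Finset HalfEdge, 2 ^ m ≤ D.card ∧
          ∀ d ∈ D, ∃ n ≤ m * ℓ, Reach K n g d := by
      intro g hg
      have hr : Reach K (n + 1) h g := ⟨a, ha, hg⟩
      rcases ih (hE.near_valid hv (hr.near hKE)) with H | H
      · obtain ⟨F, hF, hF'⟩ := exists_anchor_of_reach hKE hK hr H
        exact Or.inl ⟨F, hF, fun p hp => (hF' p hp).mono (by omega)⟩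
      · exact Or.inr H
    rcases branch g₁ hg₁ with H | ⟨D₁, hc₁, hD₁⟩
    · exact Or.inl H
    rcases branch g₂ hg₂ with H | ⟨D₂, hc₂, hD₂⟩
    · exact Or.inl H
    by_cases hd : Disjoint D₁ D₂
    · refine Or.inr ⟨D₁ ∪ D₂, ?_, ?_⟩
      · rw [Finset.card_union_of_disjoint hd, pow_succ]; omega
      · intro d hd
        rcases Finset.mem_union.1 hd with hd | hd
        · obtain ⟨s, hs, H⟩ := hD₁ d hd
          exact ⟨_, by omega, ha.trans (H.cons hg₁)⟩
        · obtain ⟨s, hs, H⟩ := hD₂ d hd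
          exact ⟨_, by omega, ha.trans (H.cons hg₂)⟩
    -- If the subtrees of the two branches share a half-edge, the branches meet; otherwise their
    -- sizes add up.
    · left
      rw [Finset.not_disjoint_iff] at hd
      obtain ⟨d, hd₁, hd₂⟩ := hd
      obtain ⟨n₁, hn₁, h₁⟩ := hD₁ d hd₁
      obtain ⟨n₂, hn₂, h₂⟩ := hD₂ d hd₂
      obtain ⟨F, hF, hF'⟩ := exists_anchor_of_branches_meet hKE hK hKt ha hg₁ hg₂ hne h₁ h₂
        hn₁ hn₂
      exact ⟨F, hF, fun p hp => (hF' p hp).mono (by omega)⟩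

end Tree

/-! ### Canonical orientations -/

/-- An orientation of finitely many edges, given by the outgoing half-edges, such that each node
touched has an outgoing and an incoming edge unless it has only one half-edge. -/
structure IsFlow (E K : Incidence) (ρ : ℕ) (P : Finset HalfEdge) : Prop where
  swap : ∀ p ∈ P, p.swap ∉ P
  good : ∀ p, p ∈ P ∨ p.swap ∈ P → ∀ q, K p q → q ≠ p →
    ∃ a b, K p a ∧ K p b ∧ a ∈ P ∧ b.swap ∈ P
  near : ∀ p ∈ P, ∀ p' ∈ P, Near E ρ p p'

/-- The half-edges that are directed away from their node. -/
def IsOut (E K : Incidence) (ρ : ℕ) (h : HalfEdge) : Prop :=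
  h ∈ leastCode {P | IsFlow E K ρ P ∧ (h ∈ P ∨ h.swap ∈ P)}

theorem isOut_swap {E K : Incidence} {ρ : ℕ} {h : HalfEdge}
    (hP : ∃ P, IsFlow E K ρ P ∧ (h ∈ P ∨ h.swap ∈ P)) :
    IsOut E K ρ h.swap ↔ ¬ IsOut E K ρ h := by
  have : {P | IsFlow E K ρ P ∧ (h.swap ∈ P ∨ h.swap.swap ∈ P)} =
      {P | IsFlow E K ρ P ∧ (h ∈ P ∨ h.swap ∈ P)} := by
    ext P
    rw [Set.mem_ofPred_eq, Set.mem_ofPred_eq, Prod.swap_swap, or_comm]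
  rw [IsOut, this, IsOut]
  obtain ⟨h1, h2⟩ := leastCode_mem (𝒱 := {P | IsFlow E K ρ P ∧ (h ∈ P ∨ h.swap ∈ P)}) hP
  constructor
  · intro h3 h4
    exact h1.swap _ h4 h3
  · intro h3
    exact h2.resolve_left h3

/-- The least flow touching the class of `h` provides an outgoing `a` and an incoming `b` there, and
it is also the flow that decides the direction of the edges of `a` and `b`. -/
theorem exists_isOut {E K : Incidence} {ρ : ℕ} (hK : ∀ h g, K h g → K g h)
    (hKt : ∀ h g f, K h g → K g f → K h f) {h g : HalfEdge}
    (hP : ∃ P, IsFlow E K ρ P ∧ (h ∈ P ∨ h.swap ∈ P)) (hg : K h g) (hne : g ≠ h) :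
    ∃ a b, K h a ∧ K h b ∧ IsOut E K ρ a ∧ IsOut E K ρ b.swap := by
  set 𝒲 := {P | IsFlow E K ρ P ∧ ∃ p, K h p ∧ (p ∈ P ∨ p.swap ∈ P)} with h𝒲
  have hhh : K h h := hKt _ _ _ hg (hK _ _ hg)
  have hne' : 𝒲.Nonempty := by
    obtain ⟨P, h1, h2⟩ := hP
    exact ⟨P, h1, h, hhh, h2⟩
  obtain ⟨h1, p, hp, hpP⟩ := leastCode_mem hne'
  obtain ⟨q, hpq, hqp⟩ : ∃ q, K p q ∧ q ≠ p := by
    by_cases hph : p = h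
    · exact ⟨g, by rw [hph]; exact hg, by rw [hph]; exact hne⟩
    · exact ⟨h, hK _ _ hp, Ne.symm hph⟩
  obtain ⟨a, b, ha, hb, haP, hbP⟩ := h1.good p hpP q hpq hqp
  have hha := hKt _ _ _ hp ha
  have hhb := hKt _ _ _ hp hb
  refine ⟨a, b, hha, hhb, ?_, ?_⟩
  · rw [IsOut, leastCode_eq_of_subset (𝒲 := 𝒲)]
    · exact haP
    · rintro P ⟨h2, h3⟩
      exact ⟨h2, a, hha, h3⟩
    · exact ⟨h1, Or.inl haP⟩
  · rw [IsOut, leastCode_eq_of_subset (𝒲 := 𝒲)]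
    · exact hbP
    · rintro P ⟨h2, h3⟩
      rw [Prod.swap_swap] at h3
      exact ⟨h2, b, hhb, h3.symm⟩
    · exact ⟨h1, Or.inl hbP⟩

-- Unite the anchors at `h` and `h.swap`. Each has one exceptional half-edge, where a partner may be
-- missing, but this half-edge belongs to the other anchor too and is not exceptional there. The
-- union is then oriented by `exists_orientation`.
open Classical in
theorem exists_isFlow {E K : Incidence} (hE : IsIncidence E)
    (hK : ∀ h g, K h g → K g h) (hKt : ∀ h g f, K h g → K g f → K h f) {r ρ : ℕ}
    {h : HalfEdge} (hv : E h h)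
    (hanchor : ∀ h, E h h → ∃ F, IsAnchor K h F ∧ ∀ p ∈ F, Near E r h p)
    (hρ : 2 * (r + 1) ≤ ρ) : ∃ P, IsFlow E K ρ P ∧ (h ∈ P ∨ h.swap ∈ P) := by
  obtain ⟨F, hF, hn⟩ := hanchor h hv
  obtain ⟨F', hF', hn'⟩ := hanchor h.swap (hE.swap hv)
  have hnear : ∀ p ∈ F ∪ F', Near E (r + 1) h p := by
    intro p hp
    rcases Finset.mem_union.1 hp with hp | hp
    · exact (hn p hp).succ
    · rw [Nat.add_comm]
      exact (Near.refl E h).swap.trans (hn' p hp)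
  have hvalid : ∀ p ∈ F ∪ F', E p p := fun p hp => hE.near_valid hv (hnear p hp)
  have hswap : ∀ p ∈ F ∪ F', p.swap ∈ F ∪ F' := by
    intro p hp
    rcases Finset.mem_union.1 hp with hp | hp
    · exact Finset.mem_union_left _ (hF.swap p hp)
    · exact Finset.mem_union_right _ (hF'.swap p hp)
  have hgood : ∀ p ∈ F ∪ F', (∀ q, K p q → q = p) ∨ ∃ q ∈ F ∪ F', q ≠ p ∧ K p q := by
    have h1 : ∀ p ∈ F, p ≠ h → (∀ q, K p q → q = p) ∨ ∃ q ∈ F ∪ F', q ≠ p ∧ K p q := by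
      intro p hp hph
      rcases hF.good p hp hph with h1 | ⟨q, h1, h2⟩
      · exact Or.inl h1
      · exact Or.inr ⟨q, Finset.mem_union_left _ h1, h2⟩
    have h2 : ∀ p ∈ F', p ≠ h.swap → (∀ q, K p q → q = p) ∨ ∃ q ∈ F ∪ F', q ≠ p ∧ K p q := by
      intro p hp hph
      rcases hF'.good p hp hph with h1 | ⟨q, h1, h2⟩
      · exact Or.inl h1
      · exact Or.inr ⟨q, Finset.mem_union_right _ h1, h2⟩
    have hne := hE.swap_ne hv
    intro p hp
    by_cases hp1 : p = h
    · subst hp1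
      refine h2 _ ?_ hne.symm
      simpa using hF'.swap _ hF'.mem
    by_cases hp2 : p = h.swap
    · subst hp2
      exact h1 _ (hF.swap _ hF.mem) hne
    rcases Finset.mem_union.1 hp with hp | hp
    · exact h1 p hp hp1
    · exact h2 p hp hp2
  obtain ⟨P, hPF, hP1, hP2⟩ := exists_orientation K hK hKt (F ∪ F') hswap
    fun p hp => hE.swap_ne (hvalid p hp)
  refine ⟨P, ⟨fun p hp H => (hP1 p (hPF hp)).1 H hp, ?_, ?_⟩, ?_⟩
  · intro p hp q hpq hqp
    have hpF : p ∈ F ∪ F' := by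
      rcases hp with hp | hp
      · exact hPF hp
      · simpa using hswap _ (hPF hp)
    rcases hgood p hpF with h1 | ⟨q', h1, h2, h3⟩
    · exact absurd (h1 q hpq) hqp
    · exact hP2 p hpF q' h1 h2.symm h3
  · intro p hp p' hp'
    exact ((hE.near_symm (hnear p (hPF hp))).trans (hnear p' (hPF hp'))).mono (by omega)
  · by_cases h1 : h ∈ P
    · exact Or.inl h1
    · exact Or.inr ((hP1 h (Finset.mem_union_left _ hF.mem)).2 h1)

/-! ### Locality of the orientation -/

section Locality

variable {E E' K K' : Incidence}

theorem Agree.isFlow_iff {ρ : ℕ} {h : HalfEdge}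
    (A : Agree E E' (2 * ρ + 2) h) (AK : ∀ p, Near E (ρ + 2) h p → ∀ q, K p q ↔ K' p q)
    {P : Finset HalfEdge} (hP : ∀ p ∈ P, Near E (ρ + 1) h p) :
    IsFlow E K ρ P ↔ IsFlow E' K' ρ P := by
  have h1 : (∀ p, p ∈ P ∨ p.swap ∈ P → ∀ q, K p q → q ≠ p →
      ∃ a b, K p a ∧ K p b ∧ a ∈ P ∧ b.swap ∈ P) ↔ (∀ p, p ∈ P ∨ p.swap ∈ P → ∀ q, K' p q → q ≠ p →
      ∃ a b, K' p a ∧ K' p b ∧ a ∈ P ∧ b.swap ∈ P) := by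
    refine forall₂_congr fun p hp => ?_
    have hpn : Near E (ρ + 2) h p := by
      rcases hp with hp | hp
      · exact (hP p hp).succ
      · simpa using (hP _ hp).swap
    simp only [AK p hpn]
  have h2 : (∀ p ∈ P, ∀ p' ∈ P, Near E ρ p p') ↔ (∀ p ∈ P, ∀ p' ∈ P, Near E' ρ p p') :=
    forall₂_congr fun p hp => forall₂_congr fun p' _ =>
      (A.at (hP p hp) (by omega)).near_iff p'
  exact ⟨fun H => ⟨H.swap, h1.1 H.good, h2.1 H.near⟩,
    fun H => ⟨H.swap, h1.2 H.good, h2.2 H.near⟩⟩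

theorem Agree.isOut_iff {ρ : ℕ} {h : HalfEdge}
    (A : Agree E E' (2 * ρ + 2) h) (AK : ∀ p, Near E (ρ + 2) h p → ∀ q, K p q ↔ K' p q) :
    IsOut E K ρ h ↔ IsOut E' K' ρ h := by
  rw [IsOut, IsOut]
  have key : ∀ P, (h ∈ P ∨ h.swap ∈ P) → (IsFlow E K ρ P ↔ IsFlow E' K' ρ P) := by
    intro P hP
    obtain ⟨p, hp, hhp⟩ : ∃ p ∈ P, Near E 1 h p := by
      rcases hP with hP | hP
      · exact ⟨h, hP, (Near.refl E h).succ⟩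
      · exact ⟨_, hP, (Near.refl E h).swap⟩
    have Ap : Agree E E' ρ p := A.at hhp (by omega)
    constructor
    · intro H
      refine (A.isFlow_iff AK fun p' hp' => ?_).1 H
      rw [Nat.add_comm]
      exact hhp.trans (H.near p hp p' hp')
    · intro H
      refine (A.isFlow_iff AK fun p' hp' => ?_).2 H
      rw [Nat.add_comm]
      exact hhp.trans ((Ap.near_iff p').2 (H.near p hp p' hp'))
  have : {P | IsFlow E K ρ P ∧ (h ∈ P ∨ h.swap ∈ P)} =
      {P | IsFlow E' K' ρ P ∧ (h ∈ P ∨ h.swap ∈ P)} := by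
    ext P
    exact and_congr_left fun hP => key P hP
  rw [this]

end Locality

/-! ### Cut trails: joined half-edges and their balance -/

section Joined

/-- `h` takes no part in the pairing of half-edges at its node, because it is left over or because
the pair is cut. -/
def IsLoose (E : Incidence) (C : HalfEdge → Prop) (h : HalfEdge) : Prop :=
  mate E h = h ∨ C h ∨ C (mate E h)

/-- The half-edges paired with each other are joined, and so are the loose half-edges at a node of
odd degree. -/
def Joined (E : Incidence) (C : HalfEdge → Prop) (h g : HalfEdge) : Prop :=
  E h g ∧ (g = h ∨ (g = mate E h ∧ ¬ IsLoose E C h) ∨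
    (IsLoose E C h ∧ IsLoose E C g ∧ ∃ s, E h s ∧ mate E s = s))

variable {E : Incidence} {C : HalfEdge → Prop}

theorem Joined.rel {h g : HalfEdge} (H : Joined E C h g) : E h g := H.1

theorem isLoose_mate (hE : IsIncidence E) {h : HalfEdge} (hv : E h h) :
    IsLoose E C (mate E h) ↔ IsLoose E C h := by
  rw [IsLoose, IsLoose, hE.mate_mate hv, or_comm (a := C h), eq_comm]

theorem Joined.symm (hE : IsIncidence E) {h g : HalfEdge} (H : Joined E C h g) :
    Joined E C g h := by
  obtain ⟨h1, h2⟩ := H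
  refine ⟨hE.symm h1, ?_⟩
  rcases h2 with h2 | ⟨h2, h3⟩ | ⟨h2, h3, s, h4, h5⟩
  · exact Or.inl h2.symm
  · subst h2
    have hv := hE.left h1
    exact Or.inr (Or.inl ⟨(hE.mate_mate hv).symm, fun H => h3 ((isLoose_mate hE hv).1 H)⟩)
  · exact Or.inr (Or.inr ⟨h3, h2, s, hE.trans (hE.symm h1) h4, h5⟩)

theorem Joined.trans (hE : IsIncidence E) {h g f : HalfEdge} (H : Joined E C h g)
    (H' : Joined E C g f) : Joined E C h f := by
  have h1 := H.1
  have h2 := H'.1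
  have hv := hE.left h1
  refine ⟨hE.trans h1 h2, ?_⟩
  rcases H.2 with h3 | ⟨h3, h4⟩ | ⟨h3, h4, s, h5, h6⟩
  · subst h3; exact H'.2
  · subst h3
    rcases H'.2 with h5 | ⟨h5, h6⟩ | ⟨h5, -⟩
    · exact Or.inr (Or.inl ⟨h5, h4⟩)
    · rw [hE.mate_mate hv] at h5
      exact Or.inl h5
    · exact absurd ((isLoose_mate hE hv).1 h5) h4
  · rcases H'.2 with h7 | ⟨-, h8⟩ | ⟨-, h8, -⟩
    · subst h7; exact Or.inr (Or.inr ⟨h3, h4, s, h5, h6⟩)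
    · exact absurd h4 h8
    · exact Or.inr (Or.inr ⟨h3, h8, s, h5, h6⟩)

/-- The joined half-edges at a loose one. -/
theorem leaf_or_branch (hE : IsIncidence E) (hC : ∀ h g, C h → C g → E h g → h = g)
    {b : HalfEdge} (hv : E b b) (hb : IsLoose E C b) :
    (∀ q, Joined E C b q → q = b) ∨
      ∃ g₁ g₂, Joined E C b g₁ ∧ Joined E C b g₂ ∧ g₁ ≠ b ∧ g₂ ≠ b ∧ g₁ ≠ g₂ := by
  by_cases hs : ∃ s, E b s ∧ mate E s = s
  swap
  · left
    rintro q ⟨-, rfl | ⟨-, h2⟩ | ⟨-, -, h3⟩⟩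
    · rfl
    · exact absurd hb h2
    · exact absurd h3 hs
  obtain ⟨s, hbs, hs⟩ := hs
  have join : ∀ q, E b q → IsLoose E C q → Joined E C b q := fun q h1 h2 =>
    ⟨h1, Or.inr (Or.inr ⟨hb, h2, s, hbs, hs⟩)⟩
  have hjs := join s hbs (Or.inl hs)
  by_cases hc : ∃ c, E b c ∧ C c ∧ mate E c ≠ c
  -- The left-over half-edge `s`, the cut half-edge `c` and its mate are three distinct joined
  -- half-edges, and `b` is one of them, as there is only one cut per node.
  · obtain ⟨c, hbc, hc, hcm⟩ := hc
    have hcv := hE.right hbc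
    have hjc := join c hbc (Or.inr (Or.inl hc))
    have hjm := join (mate E c) (hE.trans hbc (hE.rel_mate hcv))
      (Or.inr (Or.inr (by rw [hE.mate_mate hcv]; exact hc)))
    have hsc : s ≠ c := by rintro rfl; exact hcm hs
    have hsm : s ≠ mate E c := by
      rintro rfl
      rw [hE.mate_mate hcv] at hs
      exact hcm hs.symm
    right
    by_cases h1 : b = s
    · subst h1
      exact ⟨c, mate E c, hjc, hjm, hsc.symm, hsm.symm, hcm.symm⟩
    by_cases h2 : b = c
    · subst h2
      exact ⟨s, mate E b, hjs, hjm, hsc, hcm, hsm⟩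
    by_cases h3 : b = mate E c
    · rw [← h3] at hcm hsm
      exact ⟨s, c, hjs, hjc, hsm, hcm.symm, hsc⟩
    exfalso
    rcases hb with hb | hb | hb
    · exact h1 (hE.mate_fixed_unique hbs hb hs)
    · exact h2 (hC _ _ hb hc hbc)
    · apply h3
      rw [← hC _ _ hb hc (hE.trans (hE.symm (hE.rel_mate hv)) hbc), hE.mate_mate hv]
  · left
    have hall : ∀ q, E b q → IsLoose E C q → mate E q = q := by
      intro q hq hl
      by_contra hne
      have hqv := hE.right hq
      rcases hl with hl | hl | hl
      · exact hne hl
      · exact hc ⟨q, hq, hl, hne⟩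
      · exact hc ⟨_, hE.trans hq (hE.rel_mate hqv), hl, by rw [hE.mate_mate hqv]; exact Ne.symm hne⟩
    rintro q ⟨h1, rfl | ⟨-, h2⟩ | ⟨-, h2, -⟩⟩
    · rfl
    · exact absurd hb h2
    · exact (hE.mate_fixed_unique h1 (hall b hv hb) (hall q h1 h2)).symm

theorem succ_fwd (hE : IsIncidence E) {h : HalfEdge} (hv : E h h)
    (hl : ¬ IsLoose E C h.swap) : Succ (Joined E C) h (fwd E h) :=
  ⟨⟨hE.rel_mate (hE.swap hv), Or.inr (Or.inl ⟨rfl, hl⟩)⟩, fun H => hl (Or.inl H)⟩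

theorem reach_iterate_fwd (hE : IsIncidence E) {h : HalfEdge} (hv : E h h) (i : ℕ)
    (hl : ∀ j < i, ¬ IsLoose E C ((fwd E)^[j] h).swap) :
    Reach (Joined E C) i h ((fwd E)^[i] h) := by
  induction i with
  | zero => rfl
  | succ i ih =>
    rw [Function.iterate_succ_apply']
    exact ⟨_, ih fun j hj => hl j (by omega),
      succ_fwd hE (hE.iterate_fwd_valid hv i) (hl i (by omega))⟩

/-- Trails branch or end soon if they are cut in every window. -/
theorem exists_anchor_or_branch (hE : IsIncidence E) (hC : ∀ h g, C h → C g → E h g → h = g)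
    {L β : ℕ} (hL : 0 < L) (hcode : ∀ h, E h h → code h < 2 ^ β)
    (hcut : ∀ x, E x x → IsStart E L β x → ∃ i < L, C ((fwd E)^[i] x)) {h : HalfEdge}
    (hv : E h h) :
    (∃ F, IsAnchor (Joined E C) h F ∧ ∀ p ∈ F, Near E (2 * (3 * L + 1) + 1) h p) ∨
      ∃ n < 3 * L + 1, ∃ a g₁ g₂, Reach (Joined E C) n h a ∧ Succ (Joined E C) a g₁ ∧
        Succ (Joined E C) a g₂ ∧ g₁ ≠ g₂ := by
  classical
  have hKE : ∀ h g, Joined E C h g → E h g := fun _ _ H => H.rel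
  have hK : ∀ h g, Joined E C h g → Joined E C g h := fun _ _ H => H.symm hE
  by_cases hloose : ∃ i, i ≤ 3 * L ∧ IsLoose E C ((fwd E)^[i] h).swap
  · obtain ⟨hi, hl⟩ := Nat.find_spec hloose
    set i := Nat.find hloose
    have hreach : Reach (Joined E C) i h ((fwd E)^[i] h) := reach_iterate_fwd hE hv i
      fun j hj H => Nat.find_min hloose hj ⟨by omega, H⟩
    rcases leaf_or_branch hE hC (hE.swap (hE.iterate_fwd_valid hv i)) hl with H | H
    · left
      obtain ⟨F, hF, hn⟩ := exists_anchor_of_reach hKE hK hreach (exists_anchor_of_leaf H)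
      exact ⟨F, hF, fun p hp => (hn p hp).mono (by omega)⟩
    · right
      obtain ⟨g₁, g₂, h1, h2, h3, h4, h5⟩ := H
      exact ⟨i, by omega, _, g₁, g₂, hreach, ⟨h1, h3⟩, ⟨h2, h4⟩, h5⟩
  · push Not at hloose
    left
    have hv' := hE.fwd_valid hv
    -- Following the trail from `fwd E h`, the i-th half-edge is the mate of the far end of the i-th
    -- edge from `h`. So an end or a cut found there makes that far end loose.
    have hmate : ∀ i, mate E ((fwd E)^[i] (fwd E h)) = ((fwd E)^[i] h).swap ∧
        (fwd E)^[i] (fwd E h) = mate E ((fwd E)^[i] h).swap := by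
      intro i
      rw [← Function.iterate_succ_apply, Function.iterate_succ_apply', fwd,
        hE.mate_mate (hE.swap (hE.iterate_fwd_valid hv i))]
      exact ⟨rfl, rfl⟩
    rcases exists_window hE hL hcode hv' with ⟨i, hi, H⟩ | ⟨i, hi, H⟩ | ⟨p, hp1, hp2, H⟩
    · exfalso
      apply hloose i hi
      left
      have := hmate i
      rw [← this.2, ← H, this.1]
    · exfalso
      obtain ⟨j, hj, hc⟩ := hcut _ (hE.iterate_fwd_valid hv' i) H
      rw [← Function.iterate_add_apply] at hc
      apply hloose (j + i) (by omega)
      right; right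
      rw [← (hmate _).2]
      exact hc
    · have hper : (fwd E)^[p] h = h := by
        rw [← Function.iterate_succ_apply, Function.iterate_succ_apply'] at H
        have := congrArg (bwd E) H
        rwa [hE.bwd_fwd (hE.iterate_fwd_valid hv p), hE.bwd_fwd hv] at this
      obtain ⟨q, rfl⟩ : ∃ q, p = q + 1 := ⟨p - 1, by omega⟩
      have hreach : Reach (Joined E C) q h ((fwd E)^[q] h) := reach_iterate_fwd hE hv q
        fun j hj => hloose j (by omega)
      have hsucc := succ_fwd hE (hE.iterate_fwd_valid hv q) (hloose q (by omega))
      rw [← Function.iterate_succ_apply' (fwd E), hper] at hsucc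
      exact exists_anchor_of_cycle hKE hK hreach hsucc hreach (by omega)

/-- If the joined half-edges are neither all directed to nor all away from their node, then the
half-edges at every node are almost balanced. -/
theorem abs_sum_le (hE : IsIncidence E) (hC : ∀ h g, C h → C g → E h g → h = g)
    (f : HalfEdge → ℤ) (hf : ∀ h, f h = 1 ∨ f h = -1)
    (hnae : ∀ h g, Joined E C h g → g ≠ h → ∃ a b, Joined E C h a ∧ Joined E C h b ∧ f a = 1 ∧
      f b = -1) {h : HalfEdge} {s : Finset HalfEdge} (hs : ∀ g, g ∈ s ↔ E h g) :
    |∑ g ∈ s, f g| ≤ 2 ∧ (Odd s.card → |∑ g ∈ s, f g| ≤ 1) := by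
  classical
  have hvalid : ∀ g ∈ s, E g g := fun g hg => hE.right ((hs g).1 hg)
  have hrel : ∀ g ∈ s, ∀ g' ∈ s, E g g' := fun g hg g' hg' =>
    hE.trans (hE.symm ((hs g).1 hg)) ((hs g').1 hg')
  have hmate : ∀ g ∈ s, mate E g ∈ s := fun g hg =>
    (hs _).2 (hE.trans ((hs g).1 hg) (hE.rel_mate (hvalid g hg)))
  -- A half-edge that is not loose is joined only with its mate, so the two have opposite signs and
  -- cancel.
  have hsplit : ∑ g ∈ s, f g = ∑ g ∈ s.filter (IsLoose E C), f g := by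
    rw [← Finset.sum_filter_add_sum_filter_not s (IsLoose E C) f, add_eq_left]
    refine Finset.sum_involution (fun g _ => mate E g) ?_ ?_ ?_ ?_
    · intro g hg
      obtain ⟨hg, hl⟩ := Finset.mem_filter.1 hg
      have hv := hvalid g hg
      have hj : ∀ q, Joined E C g q → q = g ∨ q = mate E g := by
        rintro q ⟨-, h1 | ⟨h1, -⟩ | ⟨h1, -⟩⟩
        · exact Or.inl h1
        · exact Or.inr h1
        · exact absurd h1 hl
      obtain ⟨a, b, ha, hb, hfa, hfb⟩ := hnae g (mate E g)
        ⟨hE.rel_mate hv, Or.inr (Or.inl ⟨rfl, hl⟩)⟩ fun H => hl (Or.inl H)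
      rcases hj a ha with rfl | rfl <;> rcases hj b hb with rfl | rfl
      · rw [hfa] at hfb; norm_num at hfb
      · rw [hfa, hfb]; norm_num
      · rw [hfa, hfb]; norm_num
      · rw [hfa] at hfb; norm_num at hfb
    · intro g hg _ H
      exact (Finset.mem_filter.1 hg).2 (Or.inl H)
    · intro g hg
      obtain ⟨hg, hl⟩ := Finset.mem_filter.1 hg
      exact Finset.mem_filter.2 ⟨hmate g hg, fun H => hl ((isLoose_mate hE (hvalid g hg)).1 H)⟩
    · intro g hg
      exact hE.mate_mate (hvalid g (Finset.mem_filter.1 hg).1)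
  rw [hsplit]
  have hsub : ∀ c ∈ s, C c → s.filter (IsLoose E C) ⊆
      insert c (insert (mate E c) (s.filter fun g => mate E g = g)) := by
    intro c hc hCc g hg
    obtain ⟨hg, hl⟩ := Finset.mem_filter.1 hg
    simp only [Finset.mem_insert, Finset.mem_filter]
    rcases hl with hl | hl | hl
    · exact Or.inr (Or.inr ⟨hg, hl⟩)
    · exact Or.inl (hC _ _ hl hCc (hrel g hg c hc))
    · refine Or.inr (Or.inl ?_)
      rw [← hC _ _ hl hCc (hrel _ (hmate g hg) c hc), hE.mate_mate (hvalid g hg)]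
  have hnc : (∀ c ∈ s, ¬ C c) → s.filter (IsLoose E C) = s.filter fun g => mate E g = g := by
    intro hno
    ext g
    simp only [Finset.mem_filter]
    refine and_congr_right fun hg => ⟨?_, Or.inl⟩
    rintro (hl | hl | hl)
    · exact hl
    · exact absurd hl (hno g hg)
    · exact absurd hl (hno _ (hmate g hg))
  have habs : ∀ t : Finset HalfEdge, |∑ g ∈ t, f g| ≤ t.card := by
    intro t
    refine (Finset.abs_sum_le_sum_abs _ _).trans ?_
    rw [Finset.card_eq_sum_ones, Nat.cast_sum]
    refine Finset.sum_le_sum fun g _ => ?_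
    rcases hf g with h1 | h1 <;> rw [h1] <;> norm_num
  by_cases hfix : ∃ z ∈ s, mate E z = z
  · obtain ⟨z, hz, hzm⟩ := hfix
    have hfil : (s.filter fun g => mate E g = g) = {z} := by
      ext g
      simp only [Finset.mem_filter, Finset.mem_singleton]
      constructor
      · rintro ⟨hg, hgm⟩
        exact hE.mate_fixed_unique (hrel g hg z hz) hgm hzm
      · rintro rfl
        exact ⟨hz, hzm⟩
    have hle : |∑ g ∈ s.filter (IsLoose E C), f g| ≤ 1 := by
      by_cases hcard : (s.filter (IsLoose E C)).card ≤ 1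
      · exact (habs _).trans (by exact_mod_cast hcard)
      push Not at hcard
      obtain ⟨x, hx, y, hy, hxy⟩ := Finset.one_lt_card.1 hcard
      obtain ⟨hxs, hxl⟩ := Finset.mem_filter.1 hx
      obtain ⟨hys, hyl⟩ := Finset.mem_filter.1 hy
      obtain ⟨a, b, ha, hb, hfa, hfb⟩ := hnae x y ⟨hrel x hxs y hys,
        Or.inr (Or.inr ⟨hxl, hyl, z, hrel x hxs z hz, hzm⟩)⟩ hxy.symm
      have hmem : ∀ q, Joined E C x q → q ∈ s.filter (IsLoose E C) := by
        rintro q ⟨h1, h2⟩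
        refine Finset.mem_filter.2 ⟨(hs q).2 (hE.trans ((hs x).1 hxs) h1), ?_⟩
        rcases h2 with rfl | ⟨-, h2⟩ | ⟨-, h2, -⟩
        · exact hxl
        · exact absurd hxl h2
        · exact h2
      have hab : a ≠ b := by
        rintro rfl
        rw [hfa] at hfb; norm_num at hfb
      have ha' := hmem a ha
      have hb' : b ∈ (s.filter (IsLoose E C)).erase a := Finset.mem_erase.2 ⟨hab.symm, hmem b hb⟩
      rw [← Finset.add_sum_erase _ _ ha', ← Finset.add_sum_erase _ _ hb', hfa, hfb]
      rw [add_neg_cancel_left]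
      refine (habs _).trans ?_
      rw [Finset.card_erase_of_mem hb', Finset.card_erase_of_mem ha']
      -- Loose are at most the left-over half-edge, the cut one and its mate. As `a` and `b` cancel,
      -- at most one term remains.
      have : (s.filter (IsLoose E C)).card ≤ 3 := by
        by_cases hc : ∃ c ∈ s, C c
        · obtain ⟨c, hc, hCc⟩ := hc
          refine (Finset.card_le_card (hsub c hc hCc)).trans ?_
          rw [hfil]
          exact Finset.card_le_three
        · push Not at hc
          rw [hnc hc, hfil]; simp
      exact_mod_cast (by omega : (s.filter (IsLoose E C)).card - 1 - 1 ≤ 1)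
    exact ⟨hle.trans (by norm_num), fun _ => hle⟩
  · have hfil : (s.filter fun g => mate E g = g) = ∅ := by
      rw [Finset.filter_eq_empty_iff]
      intro g hg hgm
      exact hfix ⟨g, hg, hgm⟩
    refine ⟨(habs _).trans ?_, fun hodd => ?_⟩
    · have : (s.filter (IsLoose E C)).card ≤ 2 := by
        by_cases hc : ∃ c ∈ s, C c
        · obtain ⟨c, hc, hCc⟩ := hc
          refine (Finset.card_le_card (hsub c hc hCc)).trans ?_
          rw [hfil]
          exact Finset.card_le_two
        · push Not at hc
          rw [hnc hc, hfil]; simp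
      exact_mod_cast this
    · exfalso
      refine Nat.not_even_iff_odd.2 hodd (even_card_of_involution s (mate E) hmate
        (fun g hg => hE.mate_mate (hvalid g hg)) fun g hg H => hfix ⟨g, hg, H⟩)

theorem Agree.joined_iff {E E' : Incidence} {C C' : HalfEdge → Prop} {h : HalfEdge}
    (hE : IsIncidence E) (hv : E h h) (A : Agree E E' 1 h)
    (hCC : ∀ g, E h g → (C g ↔ C' g)) (q : HalfEdge) : Joined E C h q ↔ Joined E' C' h q := by
  have hAg : ∀ g, E h g → Agree E E' 0 g := fun g hg => A.at ((Near.refl E h).rel hg) le_rfl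
  have hloose : ∀ g, E h g → (IsLoose E C g ↔ IsLoose E' C' g) := by
    intro g hg
    have hm := hE.rel_mate (hE.right hg)
    rw [IsLoose, IsLoose, ← (hAg g hg).mate_eq, hCC g hg, hCC _ (hE.trans hg hm)]
  rw [Joined, Joined, ← A.rel q]
  refine and_congr_right fun hq => ?_
  have h1 : (∃ s, E h s ∧ mate E s = s) ↔ ∃ s, E' h s ∧ mate E' s = s := by
    refine exists_congr fun s => ?_
    rw [← A.rel s]
    exact and_congr_right fun hs => by rw [(hAg s hs).mate_eq]
  rw [hloose h hv, hloose q hq, A.mate_eq, h1]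

end Joined

/-! ### Splitting a network of bounded degree -/

section Core

/-- The orientation of the edges of `E`. -/
def Splitting (k β : ℕ) (E : Incidence) : HalfEdge → Prop :=
  IsOut E (Joined E (IsCut E (4 * k) β (2 * (β * (16 * k + 1) + 8 * k))))
    (4 * (β * (12 * k + 1)) + 4 * (12 * k + 1) + 4)

variable {E : Incidence} {k β : ℕ}

theorem splitting_spec (hE : IsIncidence E) (hk : 0 < k)
    (hcode : ∀ h, E h h → code h < 2 ^ β)
    (hsize : ∀ h, {g | E h g}.ncard ≤ 2 * k) (hfin : {h | E h h}.Finite)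
    (hcard : {h | E h h}.ncard < 2 ^ β) :
    (∀ h, E h h → (Splitting k β E h.swap ↔ ¬ Splitting k β E h)) ∧
    ∀ (f : HalfEdge → ℤ), (∀ h, (Splitting k β E h → f h = 1) ∧ (¬ Splitting k β E h → f h = -1)) →
      ∀ (h : HalfEdge) (s : Finset HalfEdge), (∀ g, g ∈ s ↔ E h g) →
        |∑ g ∈ s, f g| ≤ 2 ∧ (Odd s.card → |∑ g ∈ s, f g| ≤ 1) := by
  set ρ := 2 * (β * (16 * k + 1) + 8 * k) with hρ
  set C := IsCut E (4 * k) β ρ with hCdef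
  have hC : ∀ h g, C h → C g → E h g → h = g := fun h g h1 h2 h3 => h1.eq hE h2 h3
  have hcut : ∀ x, E x x → IsStart E (4 * k) β x → ∃ i < 4 * k, C ((fwd E)^[i] x) :=
    fun x hv hx => exists_isCut_of_exists_isCutSet hE hv hx
      (exists_isCutSet hE hk hsize hfin hcard hv hx le_rfl)
  have hKE : ∀ h g, Joined E C h g → E h g := fun _ _ H => H.rel
  have hK : ∀ h g, Joined E C h g → Joined E C g h := fun _ _ H => H.symm hE
  have hKt : ∀ h g f, Joined E C h g → Joined E C g f → Joined E C h f :=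
    fun _ _ _ H H' => H.trans hE H'
  have hanchor : ∀ h, E h h → ∃ F, IsAnchor (Joined E C) h F ∧
      ∀ p ∈ F, Near E (2 * (β * (12 * k + 1)) + 2 * (12 * k + 1) + 1) h p := by
    intro h hv
    have hL : 3 * (4 * k) + 1 = 12 * k + 1 := by ring
    rcases exists_anchor_or_tree hE hKE hK hKt (ℓ := 12 * k + 1) (by omega) (by
      intro h hv
      have := exists_anchor_or_branch hE hC (by omega) hcode hcut hv
      rwa [hL] at this) β hv with H | ⟨D, hD, hD'⟩
    · exact H
    -- After β branchings the tree would contain `2 ^ β` half-edges, more than there are.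
    · exfalso
      have : D.card ≤ {h | E h h}.ncard := by
        rw [← Set.ncard_coe_finset]
        refine Set.ncard_le_ncard (fun d hd => ?_) hfin
        obtain ⟨n, _, hn⟩ := hD' d hd
        exact hE.near_valid hv (hn.near hKE)
      omega
  have hflow : ∀ h, E h h → ∃ P, IsFlow E (Joined E C)
      (4 * (β * (12 * k + 1)) + 4 * (12 * k + 1) + 4) P ∧ (h ∈ P ∨ h.swap ∈ P) :=
    fun h hv => exists_isFlow hE hK hKt hv hanchor (by omega)
  refine ⟨fun h hv => isOut_swap (hflow h hv), fun f hf h s hs => ?_⟩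
  refine abs_sum_le hE hC f (fun h => ?_) ?_ hs
  · by_cases H : Splitting k β E h
    · exact Or.inl ((hf h).1 H)
    · exact Or.inr ((hf h).2 H)
  · intro h g hg hne
    obtain ⟨a, b, ha, hb, hoa, hob⟩ := exists_isOut hK hKt (hflow h (hE.left hg.rel)) hg hne
    refine ⟨a, b, ha, hb, (hf a).1 hoa, (hf b).2 ?_⟩
    exact (isOut_swap (hflow b (hE.right hb.rel))).1 hob

/-- The radii of the orientation, of the joined classes and of the cuts add up to O(kβ); the factor
1000 is generous. -/
theorem Agree.splitting_iff (hE : IsIncidence E) {E' : Incidence} {h : HalfEdge} (hv : E h h)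
    {r : ℕ} (A : Agree E E' r h) (hk : 0 < k) (hβ : 0 < β) (hr : 1000 * (k * β) ≤ r) :
    Splitting k β E h ↔ Splitting k β E' h := by
  have h1 : k ≤ k * β := Nat.le_mul_of_pos_right k hβ
  have h2 : β ≤ k * β := Nat.le_mul_of_pos_left β hk
  have e1 : β * (16 * k + 1) = 16 * (k * β) + β := by ring
  have e2 : β * (12 * k + 1) = 12 * (k * β) + β := by ring
  have e3 : 6 * (4 * k * β) = 24 * (k * β) := by ring
  refine Agree.isOut_iff (A.mono (by rw [e2]; omega)) fun p hp q => ?_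
  have hpv := hE.near_valid hv hp
  rw [e2] at hp
  refine Agree.joined_iff hE hpv (A.at hp (by omega)) (fun g hg => ?_) q
  refine Agree.isCut_iff hE (hE.right hg) (A.at (hp.rel hg) ?_)
  rw [e1, e3]
  omega

end Core

/-! ### Splitting nodes into groups -/

section Groups

/-- Ranking is a bijection from `S` onto the numbers below `S.card`. -/
theorem card_filter_rank (S : Finset ℕ) (P : ℕ → Prop) [DecidablePred P] :
    (S.filter fun c => P (S.filter (· < c)).card).card = ((Finset.range S.card).filter P).card := by
  have hinj : Set.InjOn (fun c => (S.filter (· < c)).card) S := by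
    have hlt : ∀ a ∈ S, ∀ b ∈ S, a < b → (S.filter (· < a)).card < (S.filter (· < b)).card := by
      intro a ha b _ hab
      refine Finset.card_lt_card ⟨fun x hx => ?_, fun H => ?_⟩
      · rw [Finset.mem_filter] at hx ⊢
        exact ⟨hx.1, hx.2.trans hab⟩
      · have := H (Finset.mem_filter.2 ⟨ha, hab⟩)
        exact lt_irrefl a (Finset.mem_filter.1 this).2
    intro a ha b hb hab
    rcases lt_trichotomy a b with h | h | h
    · exact absurd hab (hlt a ha b hb h).ne
    · exact h
    · exact absurd hab.symm (hlt b hb a ha h).ne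
  have himg : S.image (fun c => (S.filter (· < c)).card) = Finset.range S.card := by
    refine Finset.eq_of_subset_of_card_le ?_ ?_
    · intro r hr
      obtain ⟨c, hc, rfl⟩ := Finset.mem_image.1 hr
      refine Finset.mem_range.2 (Finset.card_lt_card ⟨Finset.filter_subset _ _, fun H => ?_⟩)
      exact lt_irrefl c (Finset.mem_filter.1 (H hc)).2
    · rw [Finset.card_range, Finset.card_image_of_injOn hinj]
  rw [← himg, Finset.filter_image, Finset.card_image_of_injOn]
  exact hinj.mono (Finset.coe_subset.2 (Finset.filter_subset _ _))

theorem filter_range_div (n m q : ℕ) (hm : 0 < m) :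
    (Finset.range n).filter (fun r => r / m = q) = Finset.Ico (m * q) (min n (m * q + m)) := by
  ext r
  simp only [Finset.mem_filter, Finset.mem_range, Finset.mem_Ico, lt_min_iff,
    Nat.div_eq_iff hm]
  rw [Nat.mul_comm q m]
  omega

/-- A sum over a set that is split into groups of `2 * k` elements and one smaller group. -/
theorem abs_sum_groups_le {k : ℕ} (hk : 0 < k) (S : Finset ℕ) (F : ℕ → ℤ)
    (hF : ∀ q, |∑ c ∈ S.filter (fun c => (S.filter (· < c)).card / (2 * k) = q), F c| ≤ 2 ∧
      (Odd (S.filter fun c => (S.filter (· < c)).card / (2 * k) = q).card →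
        |∑ c ∈ S.filter (fun c => (S.filter (· < c)).card / (2 * k) = q), F c| ≤ 1)) :
    |∑ c ∈ S, F c| ≤ 2 * (S.card / (2 * k) : ℕ) + 2 ∧
      (Odd S.card → |∑ c ∈ S, F c| ≤ 2 * (S.card / (2 * k) : ℕ) + 1) := by
  have hm : 0 < 2 * k := by omega
  set Q := S.card / (2 * k) with hQ
  have hmaps : ∀ c ∈ S, (S.filter (· < c)).card / (2 * k) ∈ Finset.range (Q + 1) := by
    intro c _
    rw [Finset.mem_range, Nat.lt_succ_iff]
    exact Nat.div_le_div_right (Finset.card_le_card (Finset.filter_subset _ _))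
  have hsum : ∑ c ∈ S, F c = ∑ q ∈ Finset.range (Q + 1),
      ∑ c ∈ S.filter (fun c => (S.filter (· < c)).card / (2 * k) = q), F c :=
    (Finset.sum_fiberwise_of_maps_to hmaps F).symm
  have hfirst : |∑ q ∈ Finset.range Q,
      ∑ c ∈ S.filter (fun c => (S.filter (· < c)).card / (2 * k) = q), F c| ≤ 2 * (Q : ℤ) := by
    refine (Finset.abs_sum_le_sum_abs _ _).trans ?_
    refine (Finset.sum_le_sum fun q _ => (hF q).1).trans ?_
    rw [Finset.sum_const, Finset.card_range, nsmul_eq_mul, mul_comm]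
  rw [hsum, Finset.sum_range_succ]
  refine ⟨(abs_add_le _ _).trans (add_le_add hfirst (hF Q).1), fun hodd => ?_⟩
  refine (abs_add_le _ _).trans (add_le_add hfirst ((hF Q).2 ?_))
  rw [card_filter_rank S fun r => r / (2 * k) = Q, filter_range_div _ _ _ hm, Nat.card_Ico]
  have h1 := Nat.div_add_mod S.card (2 * k)
  have h2 := Nat.mod_lt S.card hm
  rw [← hQ] at h1
  -- The last group has the ranks from `2 * k * Q` up to `S.card`, so its size has the parity of
  -- `S.card`.
  rw [min_eq_left (by omega)]
  obtain ⟨a, ha⟩ := hodd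
  have h3 : 2 * k * Q = 2 * (k * Q) := by ring
  exact ⟨a - k * Q, by omega⟩

/-- The position of `h` among the half-edges at the same node and on the same side. -/
noncomputable def rank (side : HalfEdge → Bool) (D : Set HalfEdge) (h : HalfEdge) : ℕ :=
  {c | (h.1, c) ∈ D ∧ side (h.1, c) = side h ∧ c < h.2}.ncard

/-- The half-edges of `D` with every node split into two sides, and every side into groups of
`2 * k` half-edges and one smaller group. -/
def groups (side : HalfEdge → Bool) (k : ℕ) (D : Set HalfEdge) : Incidence := fun h g =>
  h ∈ D ∧ g ∈ D ∧ h.1 = g.1 ∧ side h = side g ∧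
    rank side D h / (2 * k) = rank side D g / (2 * k)

variable {side : HalfEdge → Bool} {k : ℕ} {D D' : Set HalfEdge}

theorem groups_self_iff {h : HalfEdge} : groups side k D h h ↔ h ∈ D :=
  ⟨fun H => H.1, fun H => ⟨H, H, rfl, rfl, rfl⟩⟩

theorem isIncidence_groups (hfin : D.Finite) (hswap : ∀ h ∈ D, h.swap ∈ D)
    (hne : ∀ h ∈ D, h.swap ≠ h) : IsIncidence (groups side k D) where
  symm := fun ⟨h1, h2, h3, h4, h5⟩ => ⟨h2, h1, h3.symm, h4.symm, h5.symm⟩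
  trans := fun ⟨h1, _, h3, h4, h5⟩ ⟨_, g2, g3, g4, g5⟩ =>
    ⟨h1, g2, h3.trans g3, h4.trans g4, h5.trans g5⟩
  swap := fun H => groups_self_iff.2 (hswap _ H.1)
  swap_ne := fun H => hne _ H.1
  finite := fun _ => hfin.subset fun _ H => H.2.1

/-- The groups at a node depend only on the half-edges at this node, so a node that knows these
knows the groups. -/
theorem groups_congr {h g : HalfEdge} (hrow : ∀ c, (h.1, c) ∈ D ↔ (h.1, c) ∈ D') :
    groups side k D h g ↔ groups side k D' h g := by
  by_cases hg : h.1 = g.1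
  swap
  · exact ⟨fun H => absurd H.2.2.1 hg, fun H => absurd H.2.2.1 hg⟩
  have hh : h ∈ D ↔ h ∈ D' := hrow h.2
  have hg' : g ∈ D ↔ g ∈ D' := by
    have := hrow g.2
    rwa [hg] at this
  have hr : rank side D h = rank side D' h := by
    rw [rank, rank]; simp only [hrow]
  have hr' : rank side D g = rank side D' g := by
    rw [hg] at hrow
    rw [rank, rank]; simp only [hrow]
  rw [groups, groups, hh, hg', hr, hr']

theorem rank_eq {S : Finset ℕ} {a : ℕ} {b : Bool}
    (hS : ∀ c, c ∈ S ↔ (a, c) ∈ D ∧ side (a, c) = b) {c : ℕ} (hc : side (a, c) = b) :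
    rank side D (a, c) = (S.filter (· < c)).card := by
  rw [← Set.ncard_coe_finset, rank]
  congr 1
  ext x
  rw [Finset.mem_coe, Finset.mem_filter, hS, hc, and_assoc]
  exact Iff.rfl

theorem ncard_groups_le (hk : 0 < k) (hfin : D.Finite) (h : HalfEdge) :
    {g | groups side k D h g}.ncard ≤ 2 * k := by
  classical
  have hSfin : {c | (h.1, c) ∈ D ∧ side (h.1, c) = side h}.Finite :=
    (hfin.preimage (f := fun c => (h.1, c)) fun x _ y _ H => (Prod.mk.inj H).2).subset
      fun c hc => hc.1
  set S := hSfin.toFinset with hSdef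
  have hS : ∀ c, c ∈ S ↔ (h.1, c) ∈ D ∧ side (h.1, c) = side h := fun c => hSfin.mem_toFinset
  set q := rank side D h / (2 * k)
  set T := S.filter fun c => (S.filter (· < c)).card / (2 * k) = q with hT
  have hcard : T.card ≤ 2 * k := by
    rw [hT, card_filter_rank S fun r => r / (2 * k) = q, filter_range_div _ _ _ (by omega),
      Nat.card_Ico]
    omega
  refine le_trans ?_ hcard
  rw [← Set.ncard_coe_finset]
  refine Set.ncard_le_ncard_of_injOn Prod.snd ?_ ?_ (Finset.finite_toSet T)
  · rintro ⟨a, c⟩ ⟨-, h2, h3, h4, h5⟩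
    simp only at h3
    subst h3
    rw [Finset.mem_coe, hT, Finset.mem_filter]
    exact ⟨(hS c).2 ⟨h2, h4.symm⟩, by rw [← rank_eq hS h4.symm, ← h5]⟩
  · rintro ⟨a, c⟩ H ⟨a', c'⟩ H' hcc
    exact Prod.ext (H.2.2.1.symm.trans H'.2.2.1) hcc

theorem abs_sum_side_le (hk : 0 < k) {f : HalfEdge → ℤ}
    (hf : ∀ (h : HalfEdge) (s : Finset HalfEdge), (∀ g, g ∈ s ↔ groups side k D h g) →
      |∑ g ∈ s, f g| ≤ 2 ∧ (Odd s.card → |∑ g ∈ s, f g| ≤ 1))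
    {S : Finset ℕ} {a : ℕ} {b : Bool} (hS : ∀ c, c ∈ S ↔ (a, c) ∈ D ∧ side (a, c) = b) :
    |∑ c ∈ S, f (a, c)| ≤ 2 * (S.card / (2 * k) : ℕ) + 2 ∧
      (Odd S.card → |∑ c ∈ S, f (a, c)| ≤ 2 * (S.card / (2 * k) : ℕ) + 1) := by
  classical
  refine abs_sum_groups_le hk S (fun c => f (a, c)) fun q => ?_
  set T := S.filter fun c => (S.filter (· < c)).card / (2 * k) = q with hT
  rcases T.eq_empty_or_nonempty with h0 | ⟨c₀, hc₀⟩
  · rw [h0]; simp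
  rw [hT, Finset.mem_filter, hS] at hc₀
  obtain ⟨⟨h1, h2⟩, h3⟩ := hc₀
  have key := hf (a, c₀) (T.map ⟨fun c => (a, c), fun x y H => (Prod.mk.inj H).2⟩) (by
    rintro ⟨a', c⟩
    rw [Finset.mem_map]
    constructor
    · rintro ⟨c', hc', H⟩
      obtain ⟨rfl, rfl⟩ := Prod.mk.inj H
      rw [hT, Finset.mem_filter, hS] at hc'
      exact ⟨h1, hc'.1.1, rfl, h2.trans hc'.1.2.symm, by
        rw [rank_eq hS h2, h3, rank_eq hS hc'.1.2, hc'.2]⟩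
    · rintro ⟨-, g2, rfl, g4, g5⟩
      have g4' : side (a, c) = b := g4.symm.trans h2
      refine ⟨c, ?_, rfl⟩
      rw [hT, Finset.mem_filter, hS]
      exact ⟨⟨g2, g4'⟩, by rw [← rank_eq hS g4', ← g5, rank_eq hS h2, h3]⟩)
  rw [Finset.sum_map, Finset.card_map] at key
  exact key

end Groups

/-! ### Gathering the neighborhood by flooding -/

section Flooding

/-- What a node knows: the number of nodes, its identifier, the identifiers of its neighbors by
ports, and some half-edges of the network. -/
structure Knowledge where
  size : ℕ
  ident : ℕ
  neighbor : ℕ → ℕ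
  arcs : Set HalfEdge

open Classical in
/-- All nodes repeatedly tell their neighbors what they know, and finally compute their labels from
the half-edges they know. -/
noncomputable def flooding {Out : Type} (T : ℕ → ℕ) (F : ℕ → Set HalfEdge → HalfEdge → Out) :
    LocalAlgorithm Out where
  State := Knowledge
  Msg := ℕ × Set HalfEdge
  init n i _ := ⟨n, i, fun _ => 0, ∅⟩
  send _ s _ := (s.ident, s.arcs)
  step d s m := ⟨s.size, s.ident, fun j => if h : j < d then (m ⟨j, h⟩).1 else 0,
    s.arcs ∪ {h | ∃ i, h = (s.ident, (m i).1)} ∪ {h | ∃ i, h ∈ (m i).2}⟩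
  rounds := T
  output _ s p := F s.size s.arcs (s.ident, s.neighbor p)

variable {Out : Type} {V : Type*} [Fintype V] {G : SimpleGraph V} [DecidableRel G.Adj]

/-- The half-edges of a network. -/
def netArcs (N : Network G) : Set HalfEdge :=
  {h | ∃ v w, G.Adj v w ∧ h = (N.ident v, N.ident w)}

theorem mk_mem_netArcs {N : Network G} {v w : V} :
    (N.ident v, N.ident w) ∈ netArcs N ↔ G.Adj v w := by
  constructor
  · rintro ⟨v', w', h, H⟩
    obtain ⟨h1, h2⟩ := Prod.mk.inj H
    rwa [N.ident_injective h1, N.ident_injective h2]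
  · exact fun h => ⟨v, w, h, rfl⟩

theorem finite_netArcs (N : Network G) : (netArcs N).Finite := by
  refine (Set.finite_range fun p : V × V => (N.ident p.1, N.ident p.2)).subset ?_
  rintro h ⟨v, w, -, rfl⟩
  exact ⟨(v, w), rfl⟩

theorem ncard_netArcs_le (N : Network G) :
    (netArcs N).ncard ≤ Fintype.card V ^ 2 := by
  have h1 : netArcs N ⊆ (fun p : V × V => (N.ident p.1, N.ident p.2)) '' Set.univ := by
    rintro h ⟨v, w, -, rfl⟩
    exact ⟨(v, w), trivial, rfl⟩
  refine (Set.ncard_le_ncard h1 (Set.toFinite _)).trans ((Set.ncard_image_le Set.finite_univ).trans ?_)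
  rw [Set.ncard_univ, Nat.card_eq_fintype_card, Fintype.card_prod, sq]

theorem isIncidence_netArcs (N : Network G) (side : HalfEdge → Bool) (k : ℕ) :
    IsIncidence (groups side k (netArcs N)) := by
  refine isIncidence_groups (finite_netArcs N) ?_ ?_
  · rintro h ⟨v, w, hvw, rfl⟩
    exact ⟨w, v, hvw.symm, rfl⟩
  · rintro h ⟨v, w, hvw, rfl⟩ H
    exact hvw.ne (N.ident_injective (Prod.mk.inj H).2)

variable {T : ℕ → ℕ} {F : ℕ → Set HalfEdge → HalfEdge → Out} (N : Network G)

/-- What node `v` knows after `t` rounds. -/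
noncomputable abbrev known (T : ℕ → ℕ) (F : ℕ → Set HalfEdge → HalfEdge → Out) (N : Network G)
    (t : ℕ) (v : V) : Knowledge :=
  (flooding T F).stateAfter N t v

theorem known_ident (t : ℕ) (v : V) : (known T F N t v).ident = N.ident v := by
  induction t with
  | zero => rfl
  | succ t ih => exact ih

theorem known_size (t : ℕ) (v : V) : (known T F N t v).size = Fintype.card V := by
  induction t with
  | zero => rfl
  | succ t ih => exact ih

theorem known_neighbor (t : ℕ) (v : V) (p : Fin (G.degree v)) :
    (known T F N (t + 1) v).neighbor p = N.ident (N.port v p : V) := by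
  show (if h : (p : ℕ) < G.degree v then _ else 0) = _
  rw [dif_pos p.2]
  exact known_ident N t _

theorem known_arcs_succ (t : ℕ) (v : V) : (known T F N (t + 1) v).arcs =
    (known T F N t v).arcs ∪ {h | ∃ i : Fin (G.degree v), h = ((known T F N t v).ident,
      (known T F N t (N.port v i : V)).ident)} ∪
      {h | ∃ i : Fin (G.degree v), h ∈ (known T F N t (N.port v i : V)).arcs} := rfl

theorem known_arcs_subset (t : ℕ) (v : V) : (known T F N t v).arcs ⊆ netArcs N := by
  induction t generalizing v with
  | zero => exact Set.empty_subset _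
  | succ t ih =>
    rw [known_arcs_succ]
    refine Set.union_subset (Set.union_subset (ih v) ?_) ?_
    · rintro h ⟨i, rfl⟩
      rw [known_ident, known_ident]
      exact ⟨v, _, (N.port v i).2, rfl⟩
    · rintro h ⟨i, hi⟩
      exact ih _ hi

theorem mem_known_arcs {v u w : V} (p : G.Walk v u) (hw : G.Adj u w) (t : ℕ)
    (ht : p.length < t) : (N.ident u, N.ident w) ∈ (known T F N t v).arcs := by
  induction p generalizing t with
  | nil =>
    rename_i v
    obtain ⟨t, rfl⟩ : ∃ s, t = s + 1 := ⟨t - 1, by omega⟩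
    rw [known_arcs_succ]
    refine Or.inl (Or.inr ⟨N.portTo hw, ?_⟩)
    rw [known_ident, known_ident, Network.portTo, Equiv.apply_symm_apply]
  | cons hadj p ih =>
    obtain ⟨t, rfl⟩ : ∃ s, t = s + 1 := ⟨t - 1, by omega⟩
    rw [SimpleGraph.Walk.length_cons] at ht
    rw [known_arcs_succ]
    refine Or.inr ⟨N.portTo hadj, ?_⟩
    rw [Network.portTo, Equiv.apply_symm_apply]
    exact ih hw t (by omega)

/-- Passing to the other half of an edge moves to an adjacent node, and the other moves stay at the
node. So balls of half-edges are no larger than balls of the graph. -/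
theorem exists_walk_of_near {side : HalfEdge → Bool} {k r : ℕ} {v w : V} (hvw : G.Adj v w)
    {g : HalfEdge} (H : Near (groups side k (netArcs N)) r (N.ident v, N.ident w) g) :
    ∃ u, N.ident u = g.1 ∧ ∃ p : G.Walk v u, p.length ≤ r := by
  induction r generalizing g with
  | zero => cases H; exact ⟨v, rfl, SimpleGraph.Walk.nil, le_rfl⟩
  | succ r ih =>
    obtain ⟨f, hf, H⟩ := H
    obtain ⟨u, hu, p, hp⟩ := ih hf
    have hfv := (isIncidence_netArcs N side k).near_valid (groups_self_iff.2 ⟨v, w, hvw, rfl⟩) hf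
    rcases H with rfl | rfl | H
    · exact ⟨u, hu, p, by omega⟩
    · obtain ⟨u', w', huw, rfl⟩ := hfv.1
      cases N.ident_injective hu
      exact ⟨w', rfl, p.concat huw, by rw [SimpleGraph.Walk.length_concat]; omega⟩
    · exact ⟨u, hu.trans H.2.2.1, p, by omega⟩

/-- One round more than the radius is needed, since nodes do not know the identifiers of their
neighbors initially. -/
theorem agree_known (side : HalfEdge → Bool) (k : ℕ) {r t : ℕ} {v w : V} (hvw : G.Adj v w)
    (hrt : r < t) : Agree (groups side k (netArcs N)) (groups side k (known T F N t v).arcs) r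
      (N.ident v, N.ident w) := by
  intro g hg f
  obtain ⟨u, hu, p, hp⟩ := exists_walk_of_near N hvw hg
  refine groups_congr fun c => ⟨?_, fun H => known_arcs_subset N t v H⟩
  rintro ⟨u', w', huw, H⟩
  obtain ⟨h1, rfl⟩ := Prod.mk.inj H
  cases N.ident_injective (hu.trans h1)
  rw [h1]
  exact mem_known_arcs N p huw t (by omega)

theorem flooding_label {v w : V} (hvw : G.Adj v w) (hT : 0 < T (Fintype.card V)) :
    (flooding T F).label N hvw = F (Fintype.card V) (known T F N (T (Fintype.card V)) v).arcs
      (N.ident v, N.ident w) := by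
  show F (known T F N (T (Fintype.card V)) v).size _ ((known T F N (T (Fintype.card V)) v).ident,
    (known T F N (T (Fintype.card V)) v).neighbor (N.portTo hvw)) = _
  obtain ⟨t, ht⟩ : ∃ t, T (Fintype.card V) = t + 1 := ⟨T (Fintype.card V) - 1, by omega⟩
  rw [ht, known_size, known_ident, known_neighbor, Network.portTo, Equiv.apply_symm_apply, ← ht]
  rfl

end Flooding

/-! ### Number of rounds and numerical estimates -/

section Parameters

/-- The number of bits of the codes of half-edges in a network with `n` nodes and identifiers up to
`n ^ c`. -/
def bits (c n : ℕ) : ℕ := 2 * (c * (Nat.log 2 n + 1) + 1) + 2 * (Nat.log 2 n + 1)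

theorem code_lt {c n : ℕ} {h : HalfEdge} (h1 : h.1 ≤ n ^ c) (h2 : h.2 ≤ n ^ c) :
    code h < 2 ^ bits c n := by
  have hn : n < 2 ^ (Nat.log 2 n + 1) := Nat.lt_pow_succ_log_self (by norm_num) n
  have h3 : n ^ c ≤ 2 ^ (c * (Nat.log 2 n + 1)) := by
    rw [Nat.mul_comm, pow_mul]
    exact Nat.pow_le_pow_left hn.le c
  have h4 : max h.1 h.2 + 1 ≤ 2 ^ (c * (Nat.log 2 n + 1) + 1) := by
    have h5 : 1 ≤ 2 ^ (c * (Nat.log 2 n + 1)) := Nat.one_le_two_pow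
    have h6 : max h.1 h.2 ≤ n ^ c := max_le h1 h2
    rw [pow_succ]
    omega
  calc code h < (max h.1 h.2 + 1) ^ 2 := Nat.pair_lt_max_add_one_sq _ _
    _ ≤ (2 ^ (c * (Nat.log 2 n + 1) + 1)) ^ 2 := Nat.pow_le_pow_left h4 2
    _ = 2 ^ (2 * (c * (Nat.log 2 n + 1) + 1)) := by rw [← pow_mul, Nat.mul_comm]
    _ ≤ 2 ^ bits c n := Nat.pow_le_pow_right (by norm_num) (Nat.le_add_right _ _)

theorem sq_lt (c n : ℕ) : n ^ 2 < 2 ^ bits c n := by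
  have hn : n < 2 ^ (Nat.log 2 n + 1) := Nat.lt_pow_succ_log_self (by norm_num) n
  calc n ^ 2 < (2 ^ (Nat.log 2 n + 1)) ^ 2 := Nat.pow_lt_pow_left hn (by norm_num)
    _ = 2 ^ (2 * (Nat.log 2 n + 1)) := by rw [← pow_mul, Nat.mul_comm]
    _ ≤ 2 ^ bits c n := Nat.pow_le_pow_right (by norm_num) (Nat.le_add_left _ _)

theorem bits_pos (c n : ℕ) : 0 < bits c n := by
  unfold bits
  omega

/-- The number of rounds in which an algorithm with groups of `2 * k` half-edges gathers
information. -/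
def gatherRounds (k c n : ℕ) : ℕ := if n ≤ 1 then 0 else 1000 * (k * bits c n) + 1

theorem bits_le_log {c n : ℕ} (hn : 2 ≤ n) : (bits c n : ℝ) ≤ 3 * (2 * c + 4) * Real.log n := by
  have h1 : 2 ^ Nat.log 2 n ≤ n := Nat.pow_log_le_self 2 (by omega)
  have h2 : (Nat.log 2 n : ℝ) * Real.log 2 ≤ Real.log n := by
    rw [← Real.log_pow]
    exact Real.log_le_log (by positivity) (by exact_mod_cast h1)
  have h3 : Real.log 2 ≤ Real.log n := Real.log_le_log (by norm_num) (by exact_mod_cast hn)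
  have h4 := Real.log_two_gt_d9
  have h5 : (Nat.log 2 n : ℝ) + 1 ≤ 3 * Real.log n := by
    have : (0 : ℝ) ≤ Nat.log 2 n := Nat.cast_nonneg _
    nlinarith
  have h6 : (1 : ℝ) ≤ (Nat.log 2 n : ℝ) + 1 := by
    have : (0 : ℝ) ≤ Nat.log 2 n := Nat.cast_nonneg _
    linarith
  have h7 : (bits c n : ℝ) ≤ (2 * c + 4) * ((Nat.log 2 n : ℝ) + 1) := by
    unfold bits
    push_cast
    nlinarith
  have h8 : (0 : ℝ) ≤ 2 * c + 4 := by positivity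
  calc (bits c n : ℝ) ≤ (2 * c + 4) * ((Nat.log 2 n : ℝ) + 1) := h7
    _ ≤ (2 * c + 4) * (3 * Real.log n) := mul_le_mul_of_nonneg_left h5 h8
    _ = _ := by ring

theorem one_lt_log_four : 1 < Real.log 4 := by
  have : Real.log 4 = 2 * Real.log 2 := by
    rw [show (4 : ℝ) = 2 ^ 2 by norm_num, Real.log_pow]; norm_num
  rw [this]
  have := Real.log_two_gt_d9
  linarith

/-- The factors of the running time that exceed `a * log n` are bounded from below. -/
noncomputable def slack : ℝ := Real.log (Real.log 4) ^ (1.71 : ℝ)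

theorem slack_pos : 0 < slack := Real.rpow_pos_of_pos (Real.log_pos one_lt_log_four) _

/-- For a ≥ 4 both log a > 1 and log log a ≥ log log 4 > 0, so the logarithmic factors in a are at
least the constant `slack`. -/
theorem slack_mul_le_splittingTime (ε : ℝ) (n : ℕ) :
    slack * (max ε⁻¹ 4 * Real.log n) ≤ splittingTime ε n := by
  have ha : (4 : ℝ) ≤ max ε⁻¹ 4 := le_max_right _ _
  have h1 := one_lt_log_four
  have h2 : Real.log 4 ≤ Real.log (max ε⁻¹ 4) := Real.log_le_log (by norm_num) ha
  have h3 : Real.log (Real.log 4) ≤ Real.log (Real.log (max ε⁻¹ 4)) :=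
    Real.log_le_log (by linarith) h2
  have h4 : slack ≤ Real.log (Real.log (max ε⁻¹ 4)) ^ (1.71 : ℝ) :=
    Real.rpow_le_rpow (Real.log_pos h1).le h3 (by norm_num)
  have h5 : slack ≤ Real.log (max ε⁻¹ 4) * Real.log (Real.log (max ε⁻¹ 4)) ^ (1.71 : ℝ) := by
    have h6 : 0 < Real.log (Real.log (max ε⁻¹ 4)) ^ (1.71 : ℝ) := slack_pos.trans_le h4
    nlinarith
  have h7 : 0 ≤ max ε⁻¹ 4 * Real.log n := mul_nonneg (by linarith) (Real.log_natCast_nonneg n)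
  calc slack * (max ε⁻¹ 4 * Real.log n)
      ≤ (Real.log (max ε⁻¹ 4) * Real.log (Real.log (max ε⁻¹ 4)) ^ (1.71 : ℝ)) *
        (max ε⁻¹ 4 * Real.log n) := mul_le_mul_of_nonneg_right h5 h7
    _ = splittingTime ε n := by unfold splittingTime; ring

theorem gatherRounds_le {ε : ℝ} (hε : 0 < ε) (c n : ℕ) :
    (gatherRounds ⌈ε⁻¹⌉₊ c n : ℝ) ≤ 6006 * (2 * c + 4) / slack * splittingTime ε n := by
  have hS := slack_mul_le_splittingTime ε n
  have hs := slack_pos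
  have ha : (4 : ℝ) ≤ max ε⁻¹ 4 := le_max_right _ _
  have hlog := Real.log_natCast_nonneg n
  have hc : (0 : ℝ) ≤ 2 * c + 4 := by positivity
  have hmain : (gatherRounds ⌈ε⁻¹⌉₊ c n : ℝ) ≤
      6006 * (2 * c + 4) * (max ε⁻¹ 4 * Real.log n) := by
    -- Here log n = 0 forces zero rounds, which is enough because there are no edges.
    by_cases hn : n ≤ 1
    · rw [gatherRounds, if_pos hn, Nat.cast_zero]
      positivity
    rw [gatherRounds, if_neg hn]
    have hk : (⌈ε⁻¹⌉₊ : ℝ) ≤ 2 * max ε⁻¹ 4 := by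
      have h1 := (Nat.ceil_lt_add_one (inv_pos.2 hε).le).le
      have h2 : ε⁻¹ ≤ max ε⁻¹ 4 := le_max_left _ _
      linarith
    have hk1 : (1 : ℝ) ≤ ⌈ε⁻¹⌉₊ := by exact_mod_cast Nat.ceil_pos.2 (inv_pos.2 hε)
    have hb1 : (1 : ℝ) ≤ bits c n := by exact_mod_cast bits_pos c n
    have hb := bits_le_log (c := c) (show 2 ≤ n by omega)
    have h3 : (⌈ε⁻¹⌉₊ : ℝ) * bits c n ≤
        (2 * max ε⁻¹ 4) * (3 * (2 * c + 4) * Real.log n) :=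
      mul_le_mul hk hb (by linarith) (by linarith)
    have h4 : (1 : ℝ) ≤ (⌈ε⁻¹⌉₊ : ℝ) * bits c n := one_le_mul_of_one_le_of_one_le hk1 hb1
    push_cast
    -- 6006 = 1001 · 2 · 3: the additional round, the rounding of 1/ε, and the change from binary to
    -- natural logarithms.
    calc 1000 * ((⌈ε⁻¹⌉₊ : ℝ) * bits c n) + 1 ≤ 1001 * ((⌈ε⁻¹⌉₊ : ℝ) * bits c n) := by linarith
      _ ≤ 1001 * ((2 * max ε⁻¹ 4) * (3 * (2 * c + 4) * Real.log n)) := by linarith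
      _ = _ := by ring
  calc (gatherRounds ⌈ε⁻¹⌉₊ c n : ℝ) ≤ 6006 * (2 * c + 4) * (max ε⁻¹ 4 * Real.log n) := hmain
    _ = 6006 * (2 * c + 4) / slack * (slack * (max ε⁻¹ 4 * Real.log n)) := by
        field_simp
    _ ≤ _ := mul_le_mul_of_nonneg_left hS (by positivity)

theorem two_mul_div_le {ε : ℝ} (hε : 0 < ε) (d : ℕ) :
    (2 : ℝ) * (d / (2 * ⌈ε⁻¹⌉₊) : ℕ) ≤ ε * d := by
  have hk : ε⁻¹ ≤ (⌈ε⁻¹⌉₊ : ℝ) := Nat.le_ceil _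
  have h1 : ((d / (2 * ⌈ε⁻¹⌉₊) : ℕ) : ℝ) * (2 * ⌈ε⁻¹⌉₊) ≤ d := by
    exact_mod_cast Nat.div_mul_le_self d (2 * ⌈ε⁻¹⌉₊)
  have h2 : (1 : ℝ) ≤ ε * ⌈ε⁻¹⌉₊ := by
    calc (1 : ℝ) = ε * ε⁻¹ := (mul_inv_cancel₀ hε.ne').symm
      _ ≤ _ := mul_le_mul_of_nonneg_left hk hε.le
  have h3 : (0 : ℝ) ≤ (d / (2 * ⌈ε⁻¹⌉₊) : ℕ) := Nat.cast_nonneg _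
  calc (2 : ℝ) * (d / (2 * ⌈ε⁻¹⌉₊) : ℕ) ≤ 2 * (d / (2 * ⌈ε⁻¹⌉₊) : ℕ) * (ε * ⌈ε⁻¹⌉₊) :=
        le_mul_of_one_le_right (by linarith) h2
    _ = ε * (((d / (2 * ⌈ε⁻¹⌉₊) : ℕ) : ℝ) * (2 * ⌈ε⁻¹⌉₊)) := by ring
    _ ≤ ε * d := mul_le_mul_of_nonneg_left h1 hε.le

theorem cast_abs_le {x : ℤ} {d e : ℕ} (h : |x| ≤ 2 * (d : ℤ) + e) :
    |(x : ℝ)| ≤ 2 * (d : ℝ) + e := by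
  have := (Int.cast_le (R := ℝ)).2 h
  push_cast at this
  exact this

end Parameters

/-! ### The two algorithms -/

section Networks

variable {V : Type*} [Fintype V] {G : SimpleGraph V} [DecidableRel G.Adj]

/-- The splitting of a network. -/
def NetSplitting (side : HalfEdge → Bool) (k c : ℕ) (N : Network G) : HalfEdge → Prop :=
  Splitting k (bits c (Fintype.card V)) (groups side k (netArcs N))

theorem netSplitting_spec (side : HalfEdge → Bool) {k c : ℕ} (hk : 0 < k) (N : Network G)
    (hN : ∀ v, N.ident v ≤ Fintype.card V ^ c) :
    (∀ v w, G.Adj v w → (NetSplitting side k c N (N.ident w, N.ident v) ↔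
      ¬ NetSplitting side k c N (N.ident v, N.ident w))) ∧
    ∀ f : HalfEdge → ℤ, (∀ h, (NetSplitting side k c N h → f h = 1) ∧
        (¬ NetSplitting side k c N h → f h = -1)) → ∀ (v : V) (b : Bool) (s : Finset V),
        (∀ w, w ∈ s ↔ G.Adj v w ∧ side (N.ident v, N.ident w) = b) →
      |∑ w ∈ s, f (N.ident v, N.ident w)| ≤ 2 * (s.card / (2 * k) : ℕ) + 2 ∧
      (Odd s.card → |∑ w ∈ s, f (N.ident v, N.ident w)| ≤ 2 * (s.card / (2 * k) : ℕ) + 1) := by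
  have hset : {h | groups side k (netArcs N) h h} = netArcs N := Set.ext fun h => groups_self_iff
  obtain ⟨h1, h2⟩ := splitting_spec (β := bits c (Fintype.card V)) (isIncidence_netArcs N side k) hk
    (by rintro h ⟨⟨v, w, -, rfl⟩, -⟩; exact code_lt (hN v) (hN w))
    (fun h => ncard_groups_le hk (finite_netArcs N) h) (by rw [hset]; exact finite_netArcs N)
    (by rw [hset]; exact (ncard_netArcs_le N).trans_lt (sq_lt c _))
  refine ⟨fun v w hvw => h1 _ (groups_self_iff.2 ⟨v, w, hvw, rfl⟩), fun f hf v b s hs => ?_⟩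
  have := abs_sum_side_le (S := s.map ⟨N.ident, N.ident_injective⟩) (a := N.ident v) (b := b) hk
    (h2 f hf) (by
      intro c
      rw [Finset.mem_map]
      constructor
      · rintro ⟨w, hw, rfl⟩
        exact ⟨mk_mem_netArcs.2 ((hs w).1 hw).1, ((hs w).1 hw).2⟩
      · rintro ⟨⟨v', w, hvw, H⟩, hc⟩
        obtain ⟨h3, rfl⟩ := Prod.mk.inj H
        cases N.ident_injective h3
        exact ⟨w, (hs w).2 ⟨hvw, hc⟩, rfl⟩)
  rw [Finset.sum_map, Finset.card_map] at this
  exact this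

/-- The algorithm that labels the edges according to the splitting of the network. -/
noncomputable def splittingAlgorithm {Out : Type} (side : HalfEdge → Bool) (k c : ℕ)
    (φ : HalfEdge → Prop → Out) : LocalAlgorithm Out :=
  flooding (gatherRounds k c) fun n D h => φ h (Splitting k (bits c n) (groups side k D) h)

/-- A node evaluates `Splitting` on the half-edges it knows, and by locality this agrees with the
splitting of the whole network. -/
theorem splittingAlgorithm_label {Out : Type} (side : HalfEdge → Bool) {k c : ℕ} (hk : 0 < k)
    (φ : HalfEdge → Prop → Out) (N : Network G) {v w : V} (hvw : G.Adj v w) :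
    (splittingAlgorithm side k c φ).label N hvw =
      φ (N.ident v, N.ident w) (NetSplitting side k c N (N.ident v, N.ident w)) := by
  have hn : ¬ Fintype.card V ≤ 1 := fun H => hvw.ne (Fintype.card_le_one_iff.1 H v w)
  have hT : gatherRounds k c (Fintype.card V) =
      1000 * (k * bits c (Fintype.card V)) + 1 := if_neg hn
  rw [splittingAlgorithm, flooding_label N hvw (by omega)]
  congr 1
  refine propext (Iff.symm ?_)
  exact Agree.splitting_iff (isIncidence_netArcs N side k) (groups_self_iff.2 ⟨v, w, hvw, rfl⟩)
    (agree_known N side k hvw (r := 1000 * (k * bits c (Fintype.card V))) (by omega)) hk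
    (bits_pos _ _) le_rfl

open Classical in
theorem solvesDirectedSplitting (c : ℕ) {ε : ℝ} (hε : 0 < ε) :
    (splittingAlgorithm (fun _ => true) ⌈ε⁻¹⌉₊ c fun _ p =>
      if p then EdgeDirection.outgoing else EdgeDirection.incoming).SolvesDirectedSplitting.{u}
        c ε := by
  intro V _ G _ N hN
  have hk : 0 < ⌈ε⁻¹⌉₊ := Nat.ceil_pos.2 (inv_pos.2 hε)
  set k := ⌈ε⁻¹⌉₊
  obtain ⟨hswap, hsum⟩ := netSplitting_spec (fun _ => true) hk N hN
  set S := NetSplitting (fun _ => true) k c N with hS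
  refine ⟨⟨fun v w => G.Adj v w ∧ S (N.ident v, N.ident w)⟩, ⟨fun v w h => h.1, ?_⟩, ?_, ?_⟩
  · intro v w hvw
    have := hswap v w hvw
    by_cases h : S (N.ident v, N.ident w)
    · exact Or.inl ⟨⟨hvw, h⟩, fun H => this.1 H.2 h⟩
    · exact Or.inr ⟨⟨hvw.symm, this.2 h⟩, fun H => h H.2⟩
  · intro v w hvw
    have := hswap v w hvw
    rw [splittingAlgorithm_label _ hk]
    by_cases h : S (N.ident v, N.ident w)
    · simp [← hS, h, hvw, hvw.symm, this]
    · simp [← hS, h, hvw, hvw.symm, this]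
  · intro v
    set f : HalfEdge → ℤ := fun h => if S h then 1 else -1 with hf
    have key := hsum f (fun h => ⟨fun H => if_pos H, fun H => if_neg H⟩) v true
      (G.neighborFinset v) (fun w => by simp)
    rw [G.card_neighborFinset_eq_degree] at key
    have hout : {w | G.Adj v w ∧ S (N.ident v, N.ident w)}.ncard =
        ((G.neighborFinset v).filter fun w => S (N.ident v, N.ident w)).card := by
      rw [← Set.ncard_coe_finset]
      congr 1
      ext w
      simp
    have hin : {w | G.Adj w v ∧ S (N.ident w, N.ident v)}.ncard =
        ((G.neighborFinset v).filter fun w => ¬ S (N.ident v, N.ident w)).card := by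
      rw [← Set.ncard_coe_finset]
      congr 1
      ext w
      simp only [Set.mem_ofPred_eq, Finset.coe_filter, SimpleGraph.mem_neighborFinset]
      constructor
      · rintro ⟨h1, h2⟩
        exact ⟨h1.symm, (hswap v w h1.symm).1 h2⟩
      · rintro ⟨h1, h2⟩
        exact ⟨h1.symm, (hswap v w h1).2 h2⟩
    have hsumf : ∑ w ∈ G.neighborFinset v, f (N.ident v, N.ident w) =
        (((G.neighborFinset v).filter fun w => S (N.ident v, N.ident w)).card : ℤ) -
        ((G.neighborFinset v).filter fun w => ¬ S (N.ident v, N.ident w)).card := by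
      rw [← Finset.sum_filter_add_sum_filter_not (G.neighborFinset v)
        fun w => S (N.ident v, N.ident w)]
      rw [Finset.sum_congr rfl (g := fun _ => (1 : ℤ)) fun w hw => if_pos (Finset.mem_filter.1 hw).2,
        Finset.sum_congr rfl (g := fun _ => (-1 : ℤ)) fun w hw => if_neg (Finset.mem_filter.1 hw).2]
      rw [Finset.sum_const, Finset.sum_const]
      simp [sub_eq_add_neg]
    have hdisc : directedDiscrepancy ⟨fun v w => G.Adj v w ∧ S (N.ident v, N.ident w)⟩ v =
        |((∑ w ∈ G.neighborFinset v, f (N.ident v, N.ident w) : ℤ) : ℝ)| := by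
      rw [hsumf, directedDiscrepancy, Int.cast_sub, Int.cast_natCast, Int.cast_natCast, ← hout,
        ← hin]
    have hd := two_mul_div_le hε (G.degree v)
    rw [hdisc]
    constructor
    · intro hodd
      have h1 := cast_abs_le (e := 1) (key.2 hodd)
      rw [Nat.cast_one] at h1
      linarith
    · intro _
      have h1 := cast_abs_le (e := 2) key.1
      rw [Nat.cast_ofNat] at h1
      linarith

open Classical in
theorem solvesUndirectedSplitting (c : ℕ) {ε : ℝ} (hε : 0 < ε) :
    (splittingAlgorithm (fun h => decide (h.1 < h.2)) ⌈ε⁻¹⌉₊ c fun h p =>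
      if (p ↔ h.1 < h.2) then (1 : ℤˣ) else -1).SolvesUndirectedSplitting.{u} c ε := by
  intro V _ _ G _ N hN
  have hk : 0 < ⌈ε⁻¹⌉₊ := Nat.ceil_pos.2 (inv_pos.2 hε)
  set k := ⌈ε⁻¹⌉₊
  obtain ⟨hswap, hsum⟩ := netSplitting_spec (fun h => decide (h.1 < h.2)) hk N hN
  set S := NetSplitting (fun h => decide (h.1 < h.2)) k c N with hS
  -- Red are the edges directed from the smaller to the larger identifier. At `v`, red thus means
  -- outgoing towards larger identifiers and incoming from smaller ones, so the second side enters
  -- the sum with the opposite sign.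
  set q : Sym2 V → ℤˣ := fun e => if ∃ v w, e = s(v, w) ∧ G.Adj v w ∧ N.ident v < N.ident w ∧
    S (N.ident v, N.ident w) then 1 else -1 with hq
  have hqv : ∀ v w, G.Adj v w →
      q s(v, w) = if (S (N.ident v, N.ident w) ↔ N.ident v < N.ident w) then 1 else -1 := by
    intro v w hvw
    have hne : N.ident v ≠ N.ident w := fun H => hvw.ne (N.ident_injective H)
    have := hswap v w hvw
    have hiff : (∃ v' w', s(v, w) = s(v', w') ∧ G.Adj v' w' ∧ N.ident v' < N.ident w' ∧
        S (N.ident v', N.ident w')) ↔ (S (N.ident v, N.ident w) ↔ N.ident v < N.ident w) := by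
      constructor
      · rintro ⟨v', w', he, h1, h2, h3⟩
        rcases Sym2.eq_iff.1 he with ⟨rfl, rfl⟩ | ⟨rfl, rfl⟩
        · exact iff_of_true h3 h2
        · exact iff_of_false (this.1 h3) (by omega)
      · intro H
        rcases lt_or_gt_of_ne hne with h1 | h1
        · exact ⟨v, w, rfl, hvw, h1, H.2 h1⟩
        · exact ⟨w, v, Sym2.eq_swap, hvw.symm, h1, this.2 fun h2 => by
            have := H.1 h2
            omega⟩
    simp only [hq, hiff]
  refine ⟨q, ?_, ?_⟩
  · intro v w hvw
    rw [splittingAlgorithm_label _ hk, hqv v w hvw]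
  · intro v
    set f : HalfEdge → ℤ := fun h => if S h then 1 else -1 with hf
    set A := (G.neighborFinset v).filter fun w => N.ident v < N.ident w with hA
    set B := (G.neighborFinset v).filter fun w => ¬ N.ident v < N.ident w with hB
    have hfS : ∀ h, (S h → f h = 1) ∧ (¬ S h → f h = -1) :=
      fun h => ⟨fun H => if_pos H, fun H => if_neg H⟩
    have keyA := (hsum f hfS v true A fun w => by simp [hA]).1
    have keyB := (hsum f hfS v false B fun w => by simp [hB]).1
    have hinc : G.incidenceFinset v = (G.neighborFinset v).image fun w => s(v, w) := by
      ext e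
      simp only [SimpleGraph.mem_incidenceFinset, Finset.mem_image, SimpleGraph.mem_neighborFinset]
      constructor
      · rintro ⟨h1, h2⟩
        obtain ⟨w, rfl⟩ := h2
        exact ⟨w, h1, rfl⟩
      · rintro ⟨w, hw, rfl⟩
        exact ⟨hw, Sym2.mem_mk_left v w⟩
    have hsumq : ∑ e ∈ G.incidenceFinset v, ((q e : ℤ) : ℝ) =
        ((∑ w ∈ A, f (N.ident v, N.ident w) : ℤ) : ℝ) -
        ((∑ w ∈ B, f (N.ident v, N.ident w) : ℤ) : ℝ) := by
      rw [hinc, Finset.sum_image fun x _ y _ H => Sym2.congr_right.1 H,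
        ← Finset.sum_filter_add_sum_filter_not (G.neighborFinset v)
          fun w => N.ident v < N.ident w, sub_eq_add_neg]
      push_cast
      rw [← Finset.sum_neg_distrib]
      congr 1
      · refine Finset.sum_congr rfl fun w hw => ?_
        obtain ⟨h1, h2⟩ := Finset.mem_filter.1 hw
        rw [hqv v w (by simpa using h1)]
        by_cases h : S (N.ident v, N.ident w) <;> simp [hf, h, h2]
      · refine Finset.sum_congr rfl fun w hw => ?_
        obtain ⟨h1, h2⟩ := Finset.mem_filter.1 hw
        rw [hqv v w (by simpa using h1)]
        by_cases h : S (N.ident v, N.ident w) <;> simp [hf, h, h2]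
    have hcard : (A.card : ℝ) + B.card = G.degree v := by
      rw [← G.card_neighborFinset_eq_degree]
      exact_mod_cast Finset.card_filter_add_card_filter_not (fun w => N.ident v < N.ident w)
    have hA' := two_mul_div_le hε A.card
    have hB' := two_mul_div_le hε B.card
    have keyA' := cast_abs_le (e := 2) keyA
    have keyB' := cast_abs_le (e := 2) keyB
    rw [Nat.cast_ofNat] at keyA' keyB'
    rw [undirectedDiscrepancy, hsumq]
    refine (abs_sub _ _).trans ?_
    rw [← hcard, mul_add]
    linarith

end Networks

end DegreeSplitting

theorem theorem1 :
    ∀ c : ℕ, ∃ C : ℝ, 0 < C ∧ ∀ ε : ℝ, 0 < ε →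
      (∃ A : LocalAlgorithm EdgeDirection,
        (∀ n : ℕ, (A.rounds n : ℝ) ≤ C * splittingTime ε n) ∧
        LocalAlgorithm.SolvesDirectedSplitting.{u} A c ε) ∧
      (∃ A : LocalAlgorithm ℤˣ,
        (∀ n : ℕ, (A.rounds n : ℝ) ≤ C * splittingTime ε n) ∧
        LocalAlgorithm.SolvesUndirectedSplitting.{u} A c ε) := by
  intro c
  have hs := DegreeSplitting.slack_pos
  refine ⟨6006 * (2 * c + 4) / DegreeSplitting.slack, by positivity, fun ε hε => ⟨?_, ?_⟩⟩
  · exact ⟨_, DegreeSplitting.gatherRounds_le hε c, DegreeSplitting.solvesDirectedSplitting c hε⟩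
  · exact ⟨_, DegreeSplitting.gatherRounds_le hε c, DegreeSplitting.solvesUndirectedSplitting c hε⟩
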